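/- Let $\mu$ be a complex Borel measure on the unit circle $\mathbb T$, let $\chi(z)=(1,z^{-1},z,z^{-2},z^2,\dots)^\top$ be the CMV sequence (the case $\vec n=(1,1)$), $g=\oint_{\mathbb T}\chi(z)\chi(z)^\dagger\,d\mu(z)$ the CMV moment matrix, and $\Upsilon$ the semi-infinite matrix with $\Upsilon\chi(z)=z\chi(z)$, i.e. $\Upsilon=\sum_{j\ge0}E_{2j,2j+2}+\sum_{j\ge0}E_{2j+3,2j+1}+E_{1,0}$. For complex times $t=\{t_{1j},t_{2j}\}_{j\ge1}$ with $\sum_j|t_{1j}|<\infty$ and $\sum_j|t_{2j}|<\infty$ put $$g(t)=\exp\Big(\sum_{j\ge1}t_{1j}\Upsilon^j\Big)\,g\,\exp\Big(\sum_{j\ge1}t_{2j}(\Upsilon^\top)^j\Big)^{-1}.$$ Let $g(t)=S_1(t)^{-1}S_2(t)$ be the Gauss--Borel factorization, with $S_1$ lower triangular with unit diagonal and $S_2$ upper triangular with diagonal entries $h_l\neq0$; let $\varphi_1^{(l)}$ and $\varphi_2^{(l)}$ be the entries of $S_1\chi$ and $(S_2^{-1})^\dagger\chi$. The Verblunsky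 coefficients $\alpha^{(1)}_l(t),\alpha^{(2)}_l(t)$, $l\ge0$, are defined by $$\varphi_1^{(2m)}=\alpha^{(1)}_{2m}z^{-m}+\dots+z^m,\qquad \varphi_1^{(2m+1)}=z^{-m-1}+\dots+\bar\alpha^{(2)}_{2m+1}z^m,$$ $$\varphi_2^{(2m)}=\bar h_{2m}^{-1}\big(\alpha^{(2)}_{2m}z^{-m}+\dots+z^m\big),\qquad \varphi_2^{(2m+1)}=\bar h_{2m+1}^{-1}\big(z^{-m-1}+\dots+\bar\alpha^{(1)}_{2m+1}z^m\big),$$ so that $\alpha_0^{(1)}=\alpha_0^{(2)}=1$. (An entry of $S_1$, $S_2$, $S_2^{-1}$ depends only on finitely many entries of $g(t)$, and these formulas define each $\alpha_l^{(a)}$ and each entry of $L_1,L_2$ below on a neighbourhood of any $t$ at which all leading principal minors of $g(t)$ are non-zero.) Put $L_1=S_1\Upsilon S_1^{-1}$, $L_2=S_2\Upsilon^\top S_2^{-1}$, $B_{1,1}=(L_1)_+$ (upper triangular part, diagonal included) and $B_{2,1}=(L_2)_-$ (strictly lower triangular part). Then at every $t$ at which $g(t)$ is quasi-definite (all its leading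 principal minors are non-zero) the Lax equations $$\frac{\partial L_a}{\partial t_{11}}=[B_{1,1},L_a],\qquad \frac{\partial L_a}{\partial t_{21}}=[B_{2,1},L_a],\qquad a=1,2,$$ hold entry by entry, and, as a consequence, the Verblunsky coefficients satisfy the CMV version of the Toeplitz lattice: for all $k=1,2,\dots$ the following (complex) partial derivatives exist and $$\frac{\partial\alpha_k^{(1)}}{\partial t_{11}}=\alpha_{k+1}^{(1)}\big(1-\alpha_k^{(1)}\bar\alpha_k^{(2)}\big),\qquad \frac{\partial\bar\alpha_k^{(2)}}{\partial t_{11}}=-\bar\alpha_{k-1}^{(2)}\big(1-\alpha_k^{(1)}\bar\alpha_k^{(2)}\big),$$ $$\frac{\partial\alpha_k^{(1)}}{\partial t_{21}}=\alpha_{k-1}^{(1)}\big(1-\alpha_k^{(1)}\bar\alpha_k^{(2)}\big),\qquad \frac{\partial\bar\alpha_k^{(2)}}{\partial t_{21}}=-\bar\alpha_{k+1}^{(2)}\big(1-\alpha_k^{(1)}\bar\alpha_k^{(2)}\big).$$ -/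

import Mathlib

open MeasureTheory
open scoped ComplexConjugate

noncomputable section

namespace OLPUC

/-- Semi-infinite complex matrices, with rows and columns indexed by `0, 1, 2, …`. -/
abbrev SMat := Matrix ℕ ℕ ℂ

/-! ### Products, powers, exponentials and triangular inverses of semi-infinite matrices -/

/-- The product of two semi-infinite matrices. -/
def sMul (A B : SMat) : SMat := fun i k => ∑' j, A i j * B j k

infixl:70 " ⊠ " => sMul

/-- The powers of a semi-infinite matrix. -/
def sPow (A : SMat) : ℕ → SMat
  | 0 => 1
  | n + 1 => A ⊠ sPow A n

/-- The exponential series of a semi-infinite matrix, summed entry by entry. -/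
def sExp (A : SMat) : SMat := fun i j => ∑' n : ℕ, (n.factorial : ℂ)⁻¹ * sPow A n i j

/-- The commutator `[A, B]`. -/
def sComm (A B : SMat) : SMat := A ⊠ B - B ⊠ A

/-- The `n × n` truncation, i.e. the upper left corner. -/
def trunc (A : SMat) (n : ℕ) : Matrix (Fin n) (Fin n) ℂ := fun i j => A i j

/-- The projection onto the upper triangular matrices (diagonal included). -/
def upperPart (A : SMat) : SMat := fun i j => if i ≤ j then A i j else 0

/-- The projection onto the strictly lower triangular matrices. -/
def strictLowerPart (A : SMat) : SMat := fun i j => if j < i then A i j else 0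

/-- The inverse of a lower triangular matrix, computed on its truncations. -/
def lowerInv (A : SMat) : SMat := fun i j =>
  if h : j ≤ i then (trunc A (i + 1))⁻¹ ⟨i, Nat.lt_succ_self i⟩ ⟨j, Nat.lt_succ_of_le h⟩ else 0

/-- The inverse of an upper triangular matrix, computed on its truncations. -/
def upperInv (A : SMat) : SMat := fun i j =>
  if h : i ≤ j then (trunc A (j + 1))⁻¹ ⟨i, Nat.lt_succ_of_le h⟩ ⟨j, Nat.lt_succ_self j⟩ else 0

/-! ### The CMV moment matrix and its deformation -/

/-- The exponents `0, -1, 1, -2, 2, …` of the CMV ordering `1, z⁻¹, z, z⁻², z², …`. -/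
def cmvExp (l : ℕ) : ℤ := if Even l then ((l / 2 : ℕ) : ℤ) else -((l / 2 : ℕ) : ℤ) - 1

/-- The entries of the CMV sequence `χ(z) = (1, z⁻¹, z, z⁻², …)ᵀ`. -/
def chi (l : ℕ) (z : ℂ) : ℂ := z ^ cmvExp l

/-- The Borel `σ`-algebra of the unit circle. -/
instance : MeasurableSpace Circle := borel Circle

instance : BorelSpace Circle := ⟨rfl⟩

/-- The CMV moment matrix `g = ∮ χ(z) χ(z)† dμ(z)` of a complex Borel measure on the circle. -/
def momentMatrix (μ : ComplexMeasure Circle) : SMat := fun i j =>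
  μ.integral (fun z : Circle => chi i z * conj (chi j z)) (ContinuousLinearMap.mul ℝ ℂ)

/-- `Λ₁ = ∑ E_{2j, 2j+2}`. -/
def Lambda1 : SMat := fun i j => if Even i ∧ j = i + 2 then 1 else 0

/-- `Λ₂ = ∑ E_{2j+1, 2j+3}`. -/
def Lambda2 : SMat := fun i j => if Odd i ∧ j = i + 2 then 1 else 0

/-- `E_{1,1} Λᵀ = E_{1,0}`, where `Λ = ∑ E_{j, j+1}`. -/
def E10 : SMat := fun i j => if i = 1 ∧ j = 0 then 1 else 0

/-- `Υ = Λ₁ + Λ₂ᵀ + E_{1,1} Λᵀ`, for which `Υ χ(z) = z χ(z)`. -/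
def Upsilon : SMat := Lambda1 + Lambda2.transpose + E10

/-- `W_{1,0} = exp (∑_{j ≥ 1} t_{1j} Υ^j)`. -/
def W10 (t₁ : ℕ+ → ℂ) : SMat :=
  sExp (fun i k => ∑' j : ℕ+, t₁ j * sPow Upsilon j i k)

/-- `W_{2,0} = exp (∑_{j ≥ 1} t_{2j} (Υᵀ)^j)`. -/
def W20 (t₂ : ℕ+ → ℂ) : SMat :=
  sExp (fun i k => ∑' j : ℕ+, t₂ j * sPow Upsilon.transpose j i k)

/-- The deformed moment matrix `g(t) = W_{1,0}(t) g W_{2,0}(t)⁻¹`. The inverse of the exponential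
`W_{2,0}(t)` is the exponential of the opposite matrix, that is `W_{2,0}(-t)`. -/
def deformed (μ : ComplexMeasure Circle) (t₁ t₂ : ℕ+ → ℂ) : SMat :=
  W10 t₁ ⊠ momentMatrix μ ⊠ W20 (-t₂)

/-! ### The Gauss–Borel factorization -/

/-- Quasi-definiteness of a moment matrix: no leading principal minor vanishes. -/
def QuasiDefinite (G : SMat) : Prop := ∀ n : ℕ, (trunc G n).det ≠ 0

/-- The normalized lower triangular factor in `G = S₁⁻¹ S₂`. Its `l`-th row is
`(-(G_{l,0}, …, G_{l,l-1}) (G^{[l]})⁻¹, 1, 0, 0, …)`. -/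
def S1 (G : SMat) : SMat := fun l j =>
  if h : j < l then -∑ i : Fin l, G l i * (trunc G l)⁻¹ i ⟨j, h⟩ else if j = l then 1 else 0

/-- The upper triangular factor in `G = S₁⁻¹ S₂`. -/
def S2 (G : SMat) : SMat := S1 G ⊠ G

/-- `S₁` normalized lower triangular, `S₂` upper triangular and invertible, `S₁ G = S₂`. -/
structure IsGaussBorel (G A B : SMat) : Prop where
  diag : ∀ i, A i i = 1
  lower : ∀ i j, i < j → A i j = 0
  upper : ∀ i j, j < i → B i j = 0
  diag_ne : ∀ i, B i i ≠ 0
  fac : A ⊠ G = B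

/-- The diagonal entries `h_l` of `S₂`. -/
def hDiag (G : SMat) (l : ℕ) : ℂ := S2 G l l

/-- The Laurent polynomials `φ₁^{(l)}`, the entries of `S₁ χ(z)`. -/
def phi1 (G : SMat) (l : ℕ) : LaurentPolynomial ℂ :=
  ∑ j ∈ Finset.range (l + 1), LaurentPolynomial.C (S1 G l j) * LaurentPolynomial.T (cmvExp j)

/-- The Laurent polynomials `φ₂^{(l)}`, the entries of `(S₂⁻¹)† χ(z)`. -/
def phi2 (G : SMat) (l : ℕ) : LaurentPolynomial ℂ :=
  ∑ j ∈ Finset.range (l + 1),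
    LaurentPolynomial.C (conj (upperInv (S2 G) j l)) * LaurentPolynomial.T (cmvExp j)

/-- The Verblunsky coefficients `α_l^{(1)}`, read off from
`φ₁^{(2m)} = α_{2m}^{(1)} z^{-m} + ⋯ + z^m` and
`φ₂^{(2m+1)} = conj h_{2m+1}⁻¹ (z^{-m-1} + ⋯ + conj α_{2m+1}^{(1)} z^m)`. -/
def alpha1 (G : SMat) (l : ℕ) : ℂ :=
  if Even l then (phi1 G l).coeff (-((l / 2 : ℕ) : ℤ))
  else conj (conj (hDiag G l) * (phi2 G l).coeff ((l / 2 : ℕ) : ℤ))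

/-- The Verblunsky coefficients `α_l^{(2)}`, read off from
`φ₂^{(2m)} = conj h_{2m}⁻¹ (α_{2m}^{(2)} z^{-m} + ⋯ + z^m)` and
`φ₁^{(2m+1)} = z^{-m-1} + ⋯ + conj α_{2m+1}^{(2)} z^m`. -/
def alpha2 (G : SMat) (l : ℕ) : ℂ :=
  if Even l then conj (hDiag G l) * (phi2 G l).coeff (-((l / 2 : ℕ) : ℤ))
  else conj ((phi1 G l).coeff ((l / 2 : ℕ) : ℤ))

/-! ### Lax matrices -/

/-- `L₁ = S₁ Υ S₁⁻¹`. -/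
def L1 (G : SMat) : SMat := S1 G ⊠ Upsilon ⊠ lowerInv (S1 G)

/-- `L₂ = S₂ Υᵀ S₂⁻¹`. -/
def L2 (G : SMat) : SMat := S2 G ⊠ Upsilon.transpose ⊠ upperInv (S2 G)

/-- `B_{1,1} = (L₁)₊`. -/
def B11 (G : SMat) : SMat := upperPart (L1 G)

/-- `B_{2,1} = (L₂)₋`. -/
def B21 (G : SMat) : SMat := strictLowerPart (L2 G)

/-- `F` depends on the moment matrix; its partial derivative in `t_{11}` at `(t₁, t₂)` is `d`. -/
def HasDeriv11 (μ : ComplexMeasure Circle) (t₁ t₂ : ℕ+ → ℂ) (F : SMat → ℂ) (d : ℂ) : Prop :=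
  HasDerivAt (fun s : ℂ => F (deformed μ (Function.update t₁ 1 s) t₂)) d (t₁ 1)

/-- `F` depends on the moment matrix; its partial derivative in `t_{21}` at `(t₁, t₂)` is `d`. -/
def HasDeriv21 (μ : ComplexMeasure Circle) (t₁ t₂ : ℕ+ → ℂ) (F : SMat → ℂ) (d : ℂ) : Prop :=
  HasDerivAt (fun s : ℂ => F (deformed μ t₁ (Function.update t₂ 1 s))) d (t₂ 1)

/-- The Lax equations of the flows `t_{11}` and `t_{21}`, entry by entry. -/
def LaxEquations (μ : ComplexMeasure Circle) (t₁ t₂ : ℕ+ → ℂ) : Prop :=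
  let G := deformed μ t₁ t₂
  ∀ i j : ℕ,
    HasDeriv11 μ t₁ t₂ (fun A => L1 A i j) (sComm (B11 G) (L1 G) i j) ∧
    HasDeriv21 μ t₁ t₂ (fun A => L1 A i j) (sComm (B21 G) (L1 G) i j) ∧
    HasDeriv11 μ t₁ t₂ (fun A => L2 A i j) (sComm (B11 G) (L2 G) i j) ∧
    HasDeriv21 μ t₁ t₂ (fun A => L2 A i j) (sComm (B21 G) (L2 G) i j)

/-! ### The factors above are the factors of the factorization, and the inverses are inverses -/

lemma sMul_lower {A : SMat} (hA : ∀ i j, i < j → A i j = 0) (B : SMat) (i k : ℕ) :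
    (A ⊠ B) i k = ∑ j ∈ Finset.range (i + 1), A i j * B j k := by
  refine tsum_eq_sum fun j hj => ?_
  rw [hA i j (by simpa using hj), zero_mul]

lemma sMul_upper {B : SMat} (hB : ∀ i j, j < i → B i j = 0) (A : SMat) (i k : ℕ) :
    (A ⊠ B) i k = ∑ j ∈ Finset.range (k + 1), A i j * B j k := by
  refine tsum_eq_sum fun j hj => ?_
  rw [hB j k (by simpa using hj), mul_zero]

lemma S1_lower (G : SMat) (i j : ℕ) (h : i < j) : S1 G i j = 0 := by
  simp [S1, not_lt.2 h.le, h.ne']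

lemma S1_diag (G : SMat) (i : ℕ) : S1 G i i = 1 := by simp [S1]

lemma S2_apply (G : SMat) (l k : ℕ) :
    S2 G l k = ∑ j : Fin l, S1 G l j * G j k + G l k := by
  rw [S2, sMul_lower (S1_lower G), Finset.sum_range_succ, S1_diag, one_mul, Finset.sum_range]

lemma S2_upper {G : SMat} (hG : QuasiDefinite G) (l k : ℕ) (h : k < l) : S2 G l k = 0 := by
  have hu : IsUnit (trunc G l).det := (hG l).isUnit
  have e : ∑ j : Fin l, S1 G l j * G j k =
      -∑ i : Fin l, G l i * ∑ j : Fin l, (trunc G l)⁻¹ i j * trunc G l j ⟨k, h⟩ := by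
    simp only [S1, Fin.is_lt, dif_pos, neg_mul, Finset.sum_neg_distrib, Finset.sum_mul,
      Finset.mul_sum, trunc, Fin.eta]
    rw [Finset.sum_comm]
    simp only [mul_assoc]
  have this : ∀ i : Fin l, ∑ j : Fin l, (trunc G l)⁻¹ i j * trunc G l j ⟨k, h⟩ =
      if i = ⟨k, h⟩ then 1 else 0 := fun i => by
    rw [← Matrix.mul_apply, Matrix.nonsing_inv_mul _ hu, Matrix.one_apply]
  rw [S2_apply, e]
  simp [this]

lemma trunc_sMul {A : SMat} (hA : ∀ i j, i < j → A i j = 0) (B : SMat) (n : ℕ) :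
    trunc (A ⊠ B) n = trunc A n * trunc B n := by
  ext i k
  rw [Matrix.mul_apply]
  simp only [trunc]
  rw [sMul_lower hA, ← Finset.sum_range (fun j => A i j * B j k)]
  refine Finset.sum_subset (fun j hj => ?_) (fun j _ hj => ?_)
  · simp only [Finset.mem_range] at hj ⊢
    omega
  · rw [hA i j (by simpa using hj), zero_mul]

lemma det_trunc_lower {A : SMat} (hA : ∀ i j, i < j → A i j = 0) (n : ℕ) :
    (trunc A n).det = ∏ i : Fin n, A i i :=
  Matrix.det_of_isLowerTriangular _ fun _ _ h => hA _ _ h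

lemma det_trunc_upper {B : SMat} (hB : ∀ i j, j < i → B i j = 0) (n : ℕ) :
    (trunc B n).det = ∏ i : Fin n, B i i :=
  Matrix.det_of_isUpperTriangular fun _ _ h => hB _ _ h

/-- For a quasi-definite matrix, `S1` and `S2` are the factors of the Gauss–Borel factorization,
and these are unique. -/
theorem isGaussBorel_iff {G : SMat} (hG : QuasiDefinite G) (A B : SMat) :
    IsGaussBorel G A B ↔ A = S1 G ∧ B = S2 G := by
  constructor
  · intro h
    have hA : A = S1 G := by
      ext l j
      rcases lt_trichotomy j l with hjl | rfl | hjl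
      · have hv : ∀ C : SMat, (∀ i, C i i = 1) → (∀ i j, i < j → C i j = 0) →
            (∀ k < l, (C ⊠ G) l k = 0) →
            Matrix.vecMul (fun i : Fin l => C l i) (trunc G l) = fun k : Fin l => -G l k := by
          intro C h1 h2 h3
          ext k
          have := h3 k k.2
          rw [sMul_lower h2, Finset.sum_range_succ, h1, one_mul, Finset.sum_range] at this
          simpa [Matrix.vecMul, dotProduct, trunc] using eq_neg_of_add_eq_zero_left this
        have e := (hv A h.diag h.lower fun k hk => by rw [h.fac]; exact h.upper _ _ hk).trans
          (hv (S1 G) (S1_diag G) (S1_lower G) fun k hk => S2_upper hG _ _ hk).symm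
        have hinj := Matrix.vecMul_injective_of_isUnit
          ((Matrix.isUnit_iff_isUnit_det _).2 (hG l).isUnit)
        exact congrFun (hinj e) ⟨j, hjl⟩
      · rw [h.diag, S1_diag]
      · rw [h.lower _ _ hjl, S1_lower _ _ _ hjl]
    exact ⟨hA, by rw [← h.fac, hA, S2]⟩
  · rintro ⟨rfl, rfl⟩
    refine ⟨S1_diag G, S1_lower G, fun i j h => S2_upper hG i j h, fun i hi => ?_, rfl⟩
    have h1 : (trunc (S2 G) (i + 1)).det ≠ 0 := by
      rw [S2, trunc_sMul (S1_lower G), Matrix.det_mul, det_trunc_lower (S1_lower G)]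
      simpa [S1_diag] using hG (i + 1)
    rw [det_trunc_upper (S2_upper hG)] at h1
    exact h1 (Finset.prod_eq_zero (Finset.mem_univ (Fin.last i)) hi)

lemma trunc_upperInv {B : SMat} (hB : ∀ i j, j < i → B i j = 0) (hd : ∀ i, B i i ≠ 0) (n : ℕ) :
    trunc (upperInv B) n = (trunc B n)⁻¹ := by
  have hdet : ∀ n, IsUnit (trunc B n).det := fun n => by
    rw [det_trunc_upper hB]
    exact isUnit_iff_ne_zero.2 (Finset.prod_ne_zero_iff.2 fun i _ => hd i)
  symm
  refine Matrix.inv_eq_right_inv ?_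
  ext i k
  rw [Matrix.mul_apply, Matrix.one_apply]
  simp only [trunc]
  rw [← Finset.sum_range (fun j => B i j * upperInv B j k)]
  have hs : ∑ j ∈ Finset.range n, B i j * upperInv B j k =
      ∑ j ∈ Finset.range ((k : ℕ) + 1), B i j * upperInv B j k := by
    symm
    refine Finset.sum_subset (fun j hj => ?_) (fun j _ hj => ?_)
    · simp only [Finset.mem_range] at hj ⊢
      omega
    · rw [upperInv, dif_neg (by simpa using hj), mul_zero]
  rw [hs]
  by_cases hik : (i : ℕ) ≤ k
  · have key := congrFun (congrFun (Matrix.mul_nonsing_inv (trunc B (k + 1)) (hdet _))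
      ⟨i, Nat.lt_succ_of_le hik⟩) ⟨k, Nat.lt_succ_self _⟩
    rw [Matrix.mul_apply, Matrix.one_apply] at key
    rw [Finset.sum_range]
    simpa [upperInv, trunc, Nat.lt_succ_iff, Fin.is_le, Fin.ext_iff] using key
  · rw [if_neg (fun h => hik (by rw [h]))]
    refine Finset.sum_eq_zero fun j hj => ?_
    rw [hB i j (by simp only [Finset.mem_range] at hj; omega), zero_mul]

/-- `upperInv B` is a two-sided inverse of an invertible upper triangular matrix `B`. -/
theorem upperInv_spec {B : SMat} (hB : ∀ i j, j < i → B i j = 0) (hd : ∀ i, B i i ≠ 0) :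
    B ⊠ upperInv B = 1 ∧ upperInv B ⊠ B = 1 := by
  have hdet : ∀ n, IsUnit (trunc B n).det := fun n => by
    rw [det_trunc_upper hB]
    exact isUnit_iff_ne_zero.2 (Finset.prod_ne_zero_iff.2 fun i _ => hd i)
  have hI : ∀ i j, j < i → upperInv B i j = 0 := fun i j h => by
    rw [upperInv, dif_neg (not_le.2 h)]
  have hm : ∀ {C D : SMat}, (∀ i j, j < i → D i j = 0) → ∀ n,
      trunc (C ⊠ D) n = trunc C n * trunc D n := by
    intro C D hD n
    ext i k
    rw [Matrix.mul_apply]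
    simp only [trunc]
    rw [sMul_upper hD, ← Finset.sum_range (fun j => C i j * D j k)]
    refine Finset.sum_subset (fun j hj => ?_) (fun j _ hj => ?_)
    · simp only [Finset.mem_range] at hj ⊢
      omega
    · rw [hD j k (by simpa using hj), mul_zero]
  have ext1 : ∀ C : SMat, (∀ n, trunc C n = 1) → C = 1 := by
    intro C hC
    ext i j
    have := congrFun (congrFun (hC (i + j + 1)) ⟨i, by omega⟩) ⟨j, by omega⟩
    simpa [trunc, Matrix.one_apply] using this
  constructor
  · refine ext1 _ fun n => ?_
    rw [hm hI, trunc_upperInv hB hd, Matrix.mul_nonsing_inv _ (hdet n)]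
  · refine ext1 _ fun n => ?_
    rw [hm hB, trunc_upperInv hB hd, Matrix.nonsing_inv_mul _ (hdet n)]

lemma lowerInv_eq_transpose (A : SMat) : lowerInv A = (upperInv A.transpose).transpose := by
  ext i j
  simp only [lowerInv, upperInv, Matrix.transpose_apply]
  split_ifs with h
  · rw [show trunc A.transpose (i + 1) = (trunc A (i + 1)).transpose from rfl,
      ← Matrix.transpose_nonsing_inv, Matrix.transpose_apply]
  · rfl

lemma transpose_sMul (A B : SMat) : (A ⊠ B).transpose = B.transpose ⊠ A.transpose := by
  ext i j
  simp [sMul, mul_comm]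

/-- `lowerInv A` is a two-sided inverse of an invertible lower triangular matrix `A`. -/
theorem lowerInv_spec {A : SMat} (hA : ∀ i j, i < j → A i j = 0) (hd : ∀ i, A i i ≠ 0) :
    A ⊠ lowerInv A = 1 ∧ lowerInv A ⊠ A = 1 := by
  obtain ⟨h1, h2⟩ := upperInv_spec (B := A.transpose) (fun i j h => hA j i h) hd
  rw [lowerInv_eq_transpose]
  constructor
  · simpa [transpose_sMul] using congrArg Matrix.transpose h2
  · simpa [transpose_sMul] using congrArg Matrix.transpose h1

end OLPUC

end

open OLPUC

/-! Multiplication by `z` turns `χ` into `Υ χ`, so an absolutely summable Laurent series in `Υ`, on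
either side of a CMV moment matrix, acts only on the moment sequence, through the bilateral shift.
Hence `g(t)` is again a CMV moment matrix, that of `exp (∑ t₁ⱼ zʲ - ∑ t₂ⱼ z⁻ʲ) dμ`
(`deformed_apply`). This gives `∂G/∂t₁₁ = Υ G`, `∂G/∂t₂₁ = -G Υᵀ` and the string equation `Υ G = G
Υ`.

Differentiating `S₁ G = S₂` and dividing by `S₂` gives `X + S₁ G' S₂⁻¹ = Z`, where `X = S₁' S₁⁻¹` is
strictly lower and `Z = S₂' S₂⁻¹` is upper triangular (`exists_factor_derivs`). The middle term is
`L₁` for the first flow and `-L₂` for the second, so uniqueness of the triangular splitting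
identifies `Z = B₁₁`, respectively `X = B₂₁`. As `L₁' = [X, L₁]` and `L₂' = [Z, L₂]`, and `X - Z` is
`-L₁` or `L₂`, the Lax equations follow (`flow_fst`, `flow_snd`).

The Verblunsky coefficients are the entries `subS1` of `S₁` and `superS2` of `h S₂⁻¹` next to the
diagonal, the roles alternating with parity. Their derivatives involve only the entries of `L₁`,
`L₂` next to the diagonal. By the string equation each Lax matrix is a conjugate by `S₁` as well as
by `S₂`; the first form gives the superdiagonal and the second the subdiagonal (`L1_eq`, `L2_eq`).
The factor `1 - α⁽¹⁾ conj α⁽²⁾` is `h_{n+1} / h_n`, which comes from a reflection symmetry of the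
moments (`hRatio_eq`).

Two points need care. Infinite matrix products are associative only under band conditions.
Quasi-definiteness consists of infinitely many conditions and need not persist near `t`, so every
local statement is made for one entry, where finitely many minors matter. -/

namespace OLPUC

open scoped BoundedContinuousFunction Nat

/-! ### Absolutely summable bilateral sequences and Laurent series in Banach algebras -/

/-- The convolution of bilateral sequences. -/
noncomputable def conv (a b : ℤ → ℂ) (n : ℤ) : ℂ := ∑' m, a m * b (n - m)

/-- The convolution powers of a bilateral sequence. -/
noncomputable def convPow (a : ℤ → ℂ) : ℕ → ℤ → ℂ
  | 0 => Pi.single 0 1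
  | k + 1 => conv a (convPow a k)

/-- The exponential of a bilateral sequence for the convolution. -/
noncomputable def convExp (a : ℤ → ℂ) (n : ℤ) : ℂ := ∑' k : ℕ, (k ! : ℂ)⁻¹ * convPow a k n

/-- The shear `(m, n) ↦ (m, n - m)` of `ℤ × ℤ`. -/
def shear : ℤ × ℤ ≃ ℤ × ℤ where
  toFun p := (p.1, p.2 - p.1)
  invFun p := (p.1, p.2 + p.1)
  left_inv p := by simp
  right_inv p := by simp

/-- Absolute convergence of the double series behind a convolution; it justifies each exchange of
sums below. -/
lemma summable_norm_shear {a b : ℤ → ℂ} (ha : Summable fun n => ‖a n‖)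
    (hb : Summable fun n => ‖b n‖) :
    Summable fun p : ℤ × ℤ => ‖a p.1 * b (p.2 - p.1)‖ :=
  (shear.summable_iff (f := fun p : ℤ × ℤ => ‖a p.1 * b p.2‖)).2
    (by simpa using ha.mul_norm hb)

lemma summable_norm_conv {a b : ℤ → ℂ} (ha : Summable fun n => ‖a n‖)
    (hb : Summable fun n => ‖b n‖) :
    Summable (fun n => ‖conv a b n‖) ∧
      ∑' n, ‖conv a b n‖ ≤ (∑' n, ‖a n‖) * ∑' n, ‖b n‖ := by
  have h := summable_norm_shear ha hb
  have h' := h.prod_symm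
  have hn : ∀ n, ‖conv a b n‖ ≤ ∑' m, ‖a m * b (n - m)‖ := fun n =>
    norm_tsum_le_tsum_norm (h'.prod_factor n)
  have hs : Summable fun n => ∑' m, ‖a m * b (n - m)‖ := h'.prod
  have hc := hs.of_nonneg_of_le (fun n => norm_nonneg _) hn
  refine ⟨hc, (hc.tsum_le_tsum hn hs).trans (le_of_eq ?_)⟩
  calc ∑' n, ∑' m, ‖a m * b (n - m)‖
      = ∑' m, ∑' n, ‖a m * b (n - m)‖ :=
        Summable.tsum_comm (f := fun m n => ‖a m * b (n - m)‖) h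
    _ = ∑' m, ‖a m‖ * ∑' n, ‖b n‖ := by
        refine tsum_congr fun m => ?_
        simp only [norm_mul, tsum_mul_left]
        exact congrArg (‖a m‖ * ·) ((Equiv.subRight m).tsum_eq fun n => ‖b n‖)
    _ = _ := tsum_mul_right

lemma summable_norm_single (n : ℤ) : Summable fun m => ‖(Pi.single n 1 : ℤ → ℂ) m‖ :=
  summable_of_ne_finset_zero (s := {n}) fun m hm => by
    simp [Pi.single_eq_of_ne (show m ≠ n by simpa using hm)]

lemma summable_norm_convPow {a : ℤ → ℂ} (ha : Summable fun n => ‖a n‖) (k : ℕ) :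
    Summable (fun n => ‖convPow a k n‖) ∧ ∑' n, ‖convPow a k n‖ ≤ (∑' n, ‖a n‖) ^ k := by
  induction k with
  | zero =>
    refine ⟨summable_norm_single 0, ?_⟩
    rw [convPow, tsum_eq_single 0 fun m hm => by simp [Pi.single_eq_of_ne hm]]
    simp
  | succ k ih =>
    obtain ⟨h1, h2⟩ := summable_norm_conv ha ih.1
    refine ⟨h1, h2.trans ?_⟩
    rw [pow_succ']
    exact mul_le_mul_of_nonneg_left ih.2 (tsum_nonneg fun _ => norm_nonneg _)

/-- The `ℓ¹` norm is submultiplicative for convolution, so the `k`-th row is dominated by `‖a‖₁ ^ k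
/ k!`. -/
lemma summable_norm_convExp_terms {a : ℤ → ℂ} (ha : Summable fun n => ‖a n‖) :
    Summable fun p : ℕ × ℤ => ‖(p.1 ! : ℂ)⁻¹ * convPow a p.1 p.2‖ := by
  refine (summable_prod_of_nonneg fun _ => norm_nonneg _).2 ⟨fun k => ?_, ?_⟩
  · simpa using (summable_norm_convPow ha k).1.mul_left _
  · refine (Real.summable_pow_div_factorial (∑' n, ‖a n‖)).of_nonneg_of_le
      (fun _ => tsum_nonneg fun _ => norm_nonneg _) fun k => ?_
    simp only [norm_mul, tsum_mul_left, norm_inv, Complex.norm_natCast]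
    rw [div_eq_inv_mul]
    exact mul_le_mul_of_nonneg_left (summable_norm_convPow ha k).2 (by positivity)

lemma summable_norm_convExp {a : ℤ → ℂ} (ha : Summable fun n => ‖a n‖) :
    Summable fun n => ‖convExp a n‖ := by
  have h := (summable_norm_convExp_terms ha).prod_symm
  exact h.prod.of_nonneg_of_le (fun n => norm_nonneg _) fun n =>
    norm_tsum_le_tsum_norm (h.prod_factor n)

section BanachAlgebra

variable {𝔸 : Type*} [NormedRing 𝔸] [NormedAlgebra ℂ 𝔸]

/-- The Laurent series `∑ aₙ Uⁿ`, where `U n` stands for the `n`-th power of an invertible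
element `U`. -/
noncomputable def laurentSum (U : ℤ → 𝔸) (a : ℤ → ℂ) : 𝔸 := ∑' n, a n • U n

/-- The sequence of the powers of an invertible element, all of them of norm at most one. -/
structure IsBoundedPowers (U : ℤ → 𝔸) : Prop where
  zero : U 0 = 1
  mul : ∀ m n, U m * U n = U (m + n)
  norm_le : ∀ n, ‖U n‖ ≤ 1

variable {U : ℤ → 𝔸}

lemma laurentSum_single (n : ℤ) : laurentSum U (Pi.single n 1) = U n := by
  rw [laurentSum, tsum_eq_single n fun m hm => by simp [Pi.single_eq_of_ne hm]]
  simp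

namespace IsBoundedPowers

lemma summable_norm_smul (hU : IsBoundedPowers U) {ι : Type*} {a : ι → ℂ} (e : ι → ℤ)
    (ha : Summable fun n => ‖a n‖) : Summable fun n => ‖a n • U (e n)‖ :=
  ha.of_nonneg_of_le (fun _ => norm_nonneg _) fun i => by
    rw [norm_smul]
    exact mul_le_of_le_one_right (norm_nonneg _) (hU.norm_le _)

lemma commute_laurentSum (hU : IsBoundedPowers U) (n : ℤ) (a : ℤ → ℂ) :
    Commute (U n) (laurentSum U a) :=
  Commute.tsum_right _ fun m => Commute.smul_right
    (by rw [Commute, SemiconjBy, hU.mul, hU.mul, add_comm]) _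

variable [CompleteSpace 𝔸]

lemma laurentSum_conv (hU : IsBoundedPowers U) {a b : ℤ → ℂ} (ha : Summable fun n => ‖a n‖)
    (hb : Summable fun n => ‖b n‖) :
    laurentSum U (conv a b) = laurentSum U a * laurentSum U b := by
  have h := summable_norm_shear ha hb
  have hS : Summable fun p : ℤ × ℤ => (a p.1 * b (p.2 - p.1)) • U p.2 :=
    (hU.summable_norm_smul (fun p : ℤ × ℤ => p.2) h).of_norm
  have hb' : Summable fun n => b n • U n := (hU.summable_norm_smul id hb).of_norm
  have ha' : Summable fun n => a n • U n := (hU.summable_norm_smul id ha).of_norm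
  calc laurentSum U (conv a b) = ∑' n, ∑' m, (a m * b (n - m)) • U n := by
        refine tsum_congr fun n => ?_
        have := (h.prod_symm.prod_factor n).of_norm
        exact (Summable.tsum_smul_const this _).symm
    _ = ∑' m, ∑' n, (a m * b (n - m)) • U n :=
        Summable.tsum_comm (f := fun m n => (a m * b (n - m)) • U n) hS
    _ = ∑' m, (a m • U m) * laurentSum U b := by
        refine tsum_congr fun m => ?_
        rw [laurentSum, ← hb'.tsum_mul_left,
          ← (Equiv.addRight m).tsum_eq fun n => (a m * b (n - m)) • U n]
        refine tsum_congr fun n => ?_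
        simp [smul_smul, hU.mul, add_comm, mul_comm]
    _ = _ := ha'.tsum_mul_right _

lemma laurentSum_convPow (hU : IsBoundedPowers U) {a : ℤ → ℂ} (ha : Summable fun n => ‖a n‖)
    (k : ℕ) : laurentSum U (convPow a k) = laurentSum U a ^ k := by
  induction k with
  | zero => rw [convPow, laurentSum_single, hU.zero, pow_zero]
  | succ k ih => rw [convPow, hU.laurentSum_conv ha (summable_norm_convPow ha k).1, ih, pow_succ']

/-- Bridge from the entrywise exponential series of the statement to the exponential of a Banach
algebra, where derivatives and commutation are available. -/
lemma laurentSum_convExp (hU : IsBoundedPowers U) {a : ℤ → ℂ} (ha : Summable fun n => ‖a n‖) :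
    laurentSum U (convExp a) = NormedSpace.exp (laurentSum U a) := by
  have h := summable_norm_convExp_terms ha
  have hS : Summable fun p : ℕ × ℤ => ((p.1 ! : ℂ)⁻¹ * convPow a p.1 p.2) • U p.2 :=
    (hU.summable_norm_smul (fun p : ℕ × ℤ => p.2) h).of_norm
  calc laurentSum U (convExp a)
      = ∑' n, ∑' k : ℕ, ((k ! : ℂ)⁻¹ * convPow a k n) • U n := by
        refine tsum_congr fun n => ?_
        have := (h.prod_symm.prod_factor n).of_norm
        exact (Summable.tsum_smul_const this _).symm
    _ = ∑' k : ℕ, ∑' n, ((k ! : ℂ)⁻¹ * convPow a k n) • U n :=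
        (Summable.tsum_comm (f := fun (k : ℕ) (n : ℤ) =>
          ((k ! : ℂ)⁻¹ * convPow a k n) • U n) hS)
    _ = ∑' k : ℕ, (k ! : ℂ)⁻¹ • laurentSum U a ^ k := by
        refine tsum_congr fun k => ?_
        simp only [mul_smul]
        rw [← hU.laurentSum_convPow ha, laurentSum, Summable.tsum_const_smul]
        exact (hU.summable_norm_smul id (summable_norm_convPow ha k).1).of_norm
    _ = _ := by rw [NormedSpace.exp_eq_tsum ℂ]

end IsBoundedPowers

end BanachAlgebra

/-! ### The shift of bounded sequences -/

/-- The shift `c ↦ c (· + n)` of bounded bilateral sequences. -/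
noncomputable def shiftOp (n : ℤ) : (ℤ →ᵇ ℂ) →L[ℂ] (ℤ →ᵇ ℂ) :=
  BoundedContinuousFunction.compContinuousCLM ℂ ℂ
    (⟨fun p => p + n, continuous_of_discreteTopology⟩ : C(ℤ, ℤ))

@[simp]
lemma shiftOp_apply (n : ℤ) (c : ℤ →ᵇ ℂ) (p : ℤ) : shiftOp n c p = c (p + n) := rfl

lemma isBoundedPowers_shiftOp : IsBoundedPowers shiftOp where
  zero := by
    ext c p
    simp
  mul m n := by
    ext c p
    simp [add_assoc]
  norm_le n := BoundedContinuousFunction.norm_compContinuousCLM_le_one _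

lemma laurentSum_shiftOp_apply {a : ℤ → ℂ} (ha : Summable fun n => ‖a n‖) (c : ℤ →ᵇ ℂ) (p : ℤ) :
    laurentSum shiftOp a c p = ∑' n, a n * c (p + n) := by
  have h := (isBoundedPowers_shiftOp.summable_norm_smul id ha).of_norm.hasSum
  have h2 := (h.mapL (ContinuousLinearMap.apply ℂ (ℤ →ᵇ ℂ) c)).mapL
    (BoundedContinuousFunction.evalCLM ℂ p)
  simpa [laurentSum] using h2.tsum_eq.symm

/-! ### Toeplitz matrices in the CMV ordering -/

lemma cmvExp_even (m : ℕ) : cmvExp (2 * m) = m := by simp [cmvExp]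

lemma cmvExp_odd (m : ℕ) : cmvExp (2 * m + 1) = -m - 1 := by
  simp [cmvExp, show (2 * m + 1) / 2 = m by omega]

/-- This turns sums over CMV indices into sums over `ℤ`, so semi-infinite matrices in the CMV
ordering behave as bilateral Laurent matrices. -/
lemma cmvExp_bijective : Function.Bijective cmvExp := by
  constructor
  · intro a b h
    obtain ⟨m, rfl | rfl⟩ := Nat.even_or_odd' a <;> obtain ⟨n, rfl | rfl⟩ := Nat.even_or_odd' b <;>
      simp only [cmvExp_even, cmvExp_odd] at h <;> omega
  · intro n
    rcases le_or_gt 0 n with h | h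
    · exact ⟨2 * n.toNat, by rw [cmvExp_even]; omega⟩
    · exact ⟨2 * (-n - 1).toNat + 1, by rw [cmvExp_odd]; omega⟩

/-- The CMV ordering of the integers. -/
noncomputable def cmvEquiv : ℕ ≃ ℤ := Equiv.ofBijective cmvExp cmvExp_bijective

lemma tsum_cmvExp (f : ℤ → ℂ) : ∑' m, f (cmvExp m) = ∑' n, f n := cmvEquiv.tsum_eq f

/-- The Laurent matrix with symbol `∑ aₙ zⁿ`, in the CMV ordering. -/
def toeplitz (a : ℤ → ℂ) : SMat := fun i k => a (cmvExp k - cmvExp i)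

lemma toeplitz_sMul (a b : ℤ → ℂ) : toeplitz a ⊠ toeplitz b = toeplitz (conv a b) := by
  ext i k
  simp only [sMul, toeplitz, conv]
  rw [tsum_cmvExp fun n => a (n - cmvExp i) * b (cmvExp k - n),
    ← (Equiv.addRight (cmvExp i)).tsum_eq]
  refine tsum_congr fun n => ?_
  simp only [Equiv.coe_addRight, add_sub_cancel_right]
  congr 2
  ring

lemma toeplitz_single_zero : toeplitz (Pi.single 0 1) = 1 := by
  ext i k
  simp only [toeplitz, Pi.single_apply, Matrix.one_apply, sub_eq_zero, eq_comm (a := i)]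
  simp only [cmvExp_bijective.1.eq_iff]

lemma sPow_toeplitz (a : ℤ → ℂ) (n : ℕ) : sPow (toeplitz a) n = toeplitz (convPow a n) := by
  induction n with
  | zero => rw [sPow, convPow, toeplitz_single_zero]
  | succ n ih => rw [sPow, convPow, ih, toeplitz_sMul]

lemma sExp_toeplitz (a : ℤ → ℂ) : sExp (toeplitz a) = toeplitz (convExp a) := by
  ext i j
  simp only [sExp, sPow_toeplitz]
  rfl

lemma conv_single (m n : ℤ) :
    conv (Pi.single m 1) (Pi.single n 1) = Pi.single (m + n) 1 := by
  ext k
  rw [conv, tsum_eq_single m fun l hl => by simp [Pi.single_eq_of_ne hl]]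
  simp only [Pi.single_apply, sub_eq_iff_eq_add', if_true, one_mul]

lemma convPow_single (m : ℤ) (n : ℕ) :
    convPow (Pi.single m 1) n = Pi.single (n * m) 1 := by
  induction n with
  | zero => simp [convPow]
  | succ n ih =>
    rw [convPow, ih, conv_single]
    congr 1
    push_cast
    ring

lemma Upsilon_apply (i j : ℕ) : Upsilon i j = if cmvExp j = cmvExp i + 1 then 1 else 0 := by
  simp only [Upsilon, Matrix.add_apply, Lambda1, Lambda2, Matrix.transpose_apply, E10]
  obtain ⟨m, rfl | rfl⟩ := Nat.even_or_odd' i <;> obtain ⟨n, rfl | rfl⟩ := Nat.even_or_odd' j <;>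
    simp only [cmvExp_even, cmvExp_odd]
  · have : ¬ Odd (2 * n) := by simp
    simp only [even_two_mul, true_and, this, false_and, if_false, add_zero]
    rw [if_neg (show ¬ (2 * m = 1 ∧ 2 * n = 0) by omega), add_zero]
    exact if_congr (by omega) rfl rfl
  · rw [if_neg (by omega), if_neg (by omega), if_neg (by omega), if_neg (by omega)]
    simp
  · rw [if_neg (by omega), if_neg (by omega), zero_add, zero_add]
    exact if_congr (by omega) rfl rfl
  · have : ¬ Even (2 * m + 1) := by simp
    have h2 : Odd (2 * n + 1) := by simp
    simp only [this, h2, true_and, false_and, if_false, zero_add]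
    rw [if_neg (show ¬ (2 * m + 1 = 1 ∧ 2 * n + 1 = 0) by omega), add_zero]
    exact if_congr (by omega) rfl rfl

lemma Upsilon_eq_toeplitz : Upsilon = toeplitz (Pi.single 1 1) := by
  ext i j
  rw [Upsilon_apply]
  simp only [toeplitz, Pi.single_apply]
  exact if_congr (by omega) rfl rfl

lemma Upsilon_transpose_eq_toeplitz : Upsilon.transpose = toeplitz (Pi.single (-1) 1) := by
  ext i j
  rw [Matrix.transpose_apply, Upsilon_apply]
  simp only [toeplitz, Pi.single_apply]
  exact if_congr (by omega) rfl rfl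

/-- The bilateral sequence with `t j` at the place `ε * j`. -/
noncomputable def timeSeq (ε : ℤ) (t : ℕ+ → ℂ) : ℤ → ℂ := fun n =>
  ∑' j : ℕ+, t j * (Pi.single (j * ε) 1 : ℤ → ℂ) n

lemma sum_sPow_toeplitz (ε : ℤ) (t : ℕ+ → ℂ) :
    (fun i k => ∑' j : ℕ+, t j * sPow (toeplitz (Pi.single ε 1)) j i k) =
      toeplitz (timeSeq ε t) := by
  ext i k
  simp only [sPow_toeplitz, convPow_single]
  rfl

lemma W10_eq (t : ℕ+ → ℂ) : W10 t = toeplitz (convExp (timeSeq 1 t)) := by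
  rw [W10, Upsilon_eq_toeplitz, sum_sPow_toeplitz, sExp_toeplitz]

lemma W20_eq (t : ℕ+ → ℂ) : W20 t = toeplitz (convExp (timeSeq (-1) t)) := by
  rw [W20, Upsilon_transpose_eq_toeplitz, sum_sPow_toeplitz, sExp_toeplitz]

lemma injective_mul {ε : ℤ} (hε : ε ≠ 0) : Function.Injective fun j : ℕ+ => (j * ε : ℤ) :=
  fun a b h => by simpa [hε] using h

lemma timeSeq_eq_extend {ε : ℤ} (hε : ε ≠ 0) (t : ℕ+ → ℂ) :
    timeSeq ε t = Function.extend (fun j : ℕ+ => (j * ε : ℤ)) t 0 := by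
  ext n
  by_cases h : ∃ j : ℕ+, (j * ε : ℤ) = n
  · obtain ⟨j, rfl⟩ := h
    rw [(injective_mul hε).extend_apply t 0 j, timeSeq, tsum_eq_single j]
    · simp
    · intro k hk
      rw [Pi.single_eq_of_ne fun e => hk (injective_mul hε e).symm, mul_zero]
  · rw [Function.extend_apply' _ _ _ h, timeSeq]
    refine (tsum_congr fun j => ?_).trans tsum_zero
    rw [Pi.single_eq_of_ne fun e => h ⟨j, e.symm⟩, mul_zero]

lemma summable_norm_timeSeq {ε : ℤ} (hε : ε ≠ 0) {t : ℕ+ → ℂ} (ht : Summable fun j => ‖t j‖) :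
    Summable fun n => ‖timeSeq ε t n‖ := by
  rw [timeSeq_eq_extend hε]
  refine ((injective_mul hε).summable_iff fun n hn => ?_).1 ?_
  · rw [Function.extend_apply' _ _ _ hn]
    simp
  · simpa [Function.comp_def, (injective_mul hε).extend_apply] using ht

/-- The first time enters affinely, through the single power `ε`; the flow is therefore a
one-parameter group. -/
lemma timeSeq_update {ε : ℤ} (hε : ε ≠ 0) (t : ℕ+ → ℂ) (s : ℂ) :
    timeSeq ε (Function.update t 1 s) =
      fun n => timeSeq ε t n + (s - t 1) * (Pi.single ε 1 : ℤ → ℂ) n := by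
  ext n
  simp only [timeSeq_eq_extend hε]
  by_cases h : ∃ j : ℕ+, (j * ε : ℤ) = n
  · obtain ⟨j, rfl⟩ := h
    rw [(injective_mul hε).extend_apply _ 0 j, (injective_mul hε).extend_apply _ 0 j]
    rcases eq_or_ne j 1 with rfl | hj
    · simp
    · rw [Function.update_of_ne hj, Pi.single_eq_of_ne, mul_zero, add_zero]
      intro e
      exact hj (injective_mul hε (by simpa using e))
  · rw [Function.extend_apply' _ _ _ h, Function.extend_apply' _ _ _ h, Pi.single_eq_of_ne]
    · simp
    · rintro rfl
      exact h ⟨1, by simp⟩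

lemma summable_norm_update {t : ℕ+ → ℂ} (ht : Summable fun j => ‖t j‖) (s : ℂ) :
    Summable fun j => ‖Function.update t 1 s j‖ := by
  refine (ht.update 1 ‖s‖).congr fun j => ?_
  rcases eq_or_ne j 1 with rfl | hj
  · simp
  · simp [hj]

/-! ### The symbol of the deformed moment matrix -/

/-- The moments `∮ zⁿ dμ`. -/
noncomputable def moment (μ : ComplexMeasure Circle) : ℤ →ᵇ ℂ :=
  BoundedContinuousFunction.ofNormedAddCommGroupDiscrete
    (fun n => μ.integral (fun z : Circle => (z : ℂ) ^ n) (ContinuousLinearMap.mul ℝ ℂ))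
    -- On the circle `|zⁿ| = 1`, so the total variation bounds all moments at once.
    (‖ContinuousLinearMap.mul ℝ ℂ‖ * (μ.variation Set.univ).toReal) fun n => by
      refine VectorMeasure.norm_integral_le_lintegral_norm.trans_eq ?_
      simp only [norm_zpow, Circle.norm_coe, one_zpow]
      simp

lemma momentMatrix_apply (μ : ComplexMeasure Circle) (i j : ℕ) :
    momentMatrix μ i j = moment μ (cmvExp i - cmvExp j) := by
  simp only [momentMatrix, moment]
  refine congrArg (fun f => VectorMeasure.integral μ f _) (funext fun z => ?_)
  simp only [chi]
  rw [map_zpow₀, ← Circle.coe_inv_eq_conj, Circle.coe_inv, inv_zpow', ← zpow_add₀ z.coe_ne_zero]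
  rfl

/-- Left multiplication and, in `hankel_sMul_toeplitz`, right multiplication both become the same
Laurent series in the shift of the moments; the entries keep depending on the difference of the
exponents. -/
lemma toeplitz_sMul_hankel {a : ℤ → ℂ} (ha : Summable fun n => ‖a n‖) (c : ℤ →ᵇ ℂ) (i j : ℕ) :
    (toeplitz a ⊠ fun i j => c (cmvExp i - cmvExp j)) i j =
      laurentSum shiftOp a c (cmvExp i - cmvExp j) := by
  rw [laurentSum_shiftOp_apply ha]
  simp only [sMul, toeplitz]
  rw [tsum_cmvExp fun n => a (n - cmvExp i) * c (n - cmvExp j),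
    ← (Equiv.addRight (cmvExp i)).tsum_eq]
  refine tsum_congr fun n => ?_
  simp only [Equiv.coe_addRight, add_sub_cancel_right]
  congr 2
  ring

lemma hankel_sMul_toeplitz {a : ℤ → ℂ} (ha : Summable fun n => ‖a n‖) (c : ℤ →ᵇ ℂ) (i j : ℕ) :
    ((fun i j => c (cmvExp i - cmvExp j)) ⊠ toeplitz a) i j =
      laurentSum shiftOp a c (cmvExp i - cmvExp j) := by
  rw [laurentSum_shiftOp_apply ha]
  simp only [sMul, toeplitz]
  rw [tsum_cmvExp fun n => c (cmvExp i - n) * a (cmvExp j - n),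
    ← (Equiv.subLeft (cmvExp j)).tsum_eq]
  refine tsum_congr fun n => ?_
  simp only [Equiv.subLeft_apply, sub_sub_cancel]
  rw [mul_comm]
  congr 2
  ring

/-- The moments of the deformed measure `exp (∑ t₁ⱼ zʲ - ∑ t₂ⱼ z⁻ʲ) dμ`. -/
noncomputable def deformedMoment (μ : ComplexMeasure Circle) (t₁ t₂ : ℕ+ → ℂ) : ℤ →ᵇ ℂ :=
  (NormedSpace.exp (laurentSum shiftOp (timeSeq (-1) (-t₂))) *
    NormedSpace.exp (laurentSum shiftOp (timeSeq 1 t₁))) (moment μ)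

lemma deformed_apply (μ : ComplexMeasure Circle) {t₁ t₂ : ℕ+ → ℂ}
    (ht₁ : Summable fun j => ‖t₁ j‖) (ht₂ : Summable fun j => ‖t₂ j‖) (i j : ℕ) :
    deformed μ t₁ t₂ i j = deformedMoment μ t₁ t₂ (cmvExp i - cmvExp j) := by
  have h1 := summable_norm_timeSeq one_ne_zero ht₁
  have h2 : Summable fun n => ‖timeSeq (-1) (-t₂) n‖ :=
    summable_norm_timeSeq (by simp) (by simpa using ht₂)
  have hm : momentMatrix μ = fun i j => moment μ (cmvExp i - cmvExp j) := by
    ext i j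
    exact momentMatrix_apply μ i j
  have e1 : W10 t₁ ⊠ momentMatrix μ = fun i j =>
      laurentSum shiftOp (convExp (timeSeq 1 t₁)) (moment μ) (cmvExp i - cmvExp j) := by
    ext i j
    rw [W10_eq, hm, toeplitz_sMul_hankel (summable_norm_convExp h1)]
  rw [deformed, e1, W20_eq, hankel_sMul_toeplitz (summable_norm_convExp h2),
    isBoundedPowers_shiftOp.laurentSum_convExp h1, isBoundedPowers_shiftOp.laurentSum_convExp h2]
  rfl

/-! ### Derivative of the exponentials in the first times -/

section

variable {𝔸 : Type*} [NormedRing 𝔸] [NormedAlgebra ℂ 𝔸] [CompleteSpace 𝔸] {U : ℤ → 𝔸}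

lemma IsBoundedPowers.hasDerivAt_exp_update (hU : IsBoundedPowers U) {ε : ℤ} (hε : ε ≠ 0)
    {t : ℕ+ → ℂ} (ht : Summable fun j => ‖t j‖) :
    HasDerivAt (fun s => NormedSpace.exp (laurentSum U (timeSeq ε (Function.update t 1 s))))
      (U ε * NormedSpace.exp (laurentSum U (timeSeq ε t))) (t 1) := by
  have hs : Summable fun n => timeSeq ε t n • U n :=
    (hU.summable_norm_smul id (summable_norm_timeSeq hε ht)).of_norm
  have h0 : Summable fun n => (Pi.single ε 1 : ℤ → ℂ) n • U n :=
    (hU.summable_norm_smul id (summable_norm_single ε)).of_norm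
  have e : ∀ s, laurentSum U (timeSeq ε (Function.update t 1 s)) =
      (s - t 1) • U ε + laurentSum U (timeSeq ε t) := fun s => by
    rw [timeSeq_update hε, ← laurentSum_single (U := U) ε, add_comm]
    simp only [laurentSum, add_smul, mul_smul]
    rw [hs.tsum_add (h0.const_smul _), h0.tsum_const_smul]
  have e2 : ∀ s, NormedSpace.exp (laurentSum U (timeSeq ε (Function.update t 1 s))) =
      NormedSpace.exp ((s - t 1) • U ε) * NormedSpace.exp (laurentSum U (timeSeq ε t)) := by
    intro s
    let _ : NormedAlgebra ℚ 𝔸 := NormedAlgebra.restrictScalars ℚ ℂ 𝔸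
    rw [e, NormedSpace.exp_add_of_commute]
    exact (hU.commute_laurentSum _ _).smul_left _
  simp only [e2]
  -- The one-parameter group is differentiated at its origin, which is then translated to `t 1`.
  have h := (hasDerivAt_exp_smul_const (𝕂 := ℂ) (U ε) 0)
  rw [← sub_self (t 1)] at h
  have h' := h.comp_sub_const (t 1) (t 1)
  simpa using h'.mul_const (NormedSpace.exp (laurentSum U (timeSeq ε t)))

lemma IsBoundedPowers.hasDerivAt_exp_neg_update (hU : IsBoundedPowers U) {ε : ℤ} (hε : ε ≠ 0)
    {t : ℕ+ → ℂ} (ht : Summable fun j => ‖t j‖) (b : 𝔸) :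
    HasDerivAt (fun s => NormedSpace.exp (laurentSum U (timeSeq ε (-Function.update t 1 s))) * b)
      (-(U ε * (NormedSpace.exp (laurentSum U (timeSeq ε (-t))) * b))) (t 1) := by
  have hn : ∀ s, -Function.update t 1 s = Function.update (-t) 1 (-s) := fun s => by
    ext j
    rcases eq_or_ne j 1 with rfl | hj
    · simp
    · simp [hj]
  have h := hU.hasDerivAt_exp_update hε (t := -t) (by simpa using ht)
  simp only [hn]
  exact ((HasDerivAt.scomp (t 1) h (hasDerivAt_neg (t 1))).mul_const b).congr_deriv
    (by simp [mul_assoc])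

end

lemma hasDerivAt_deformedMoment_fst (μ : ComplexMeasure Circle) {t₁ : ℕ+ → ℂ} (t₂ : ℕ+ → ℂ)
    (ht₁ : Summable fun j => ‖t₁ j‖) (n : ℤ) :
    HasDerivAt (fun s => deformedMoment μ (Function.update t₁ 1 s) t₂ n)
      (deformedMoment μ t₁ t₂ (n + 1)) (t₁ 1) := by
  have h := (isBoundedPowers_shiftOp.hasDerivAt_exp_update one_ne_zero ht₁).const_mul
    (NormedSpace.exp (laurentSum shiftOp (timeSeq (-1) (-t₂))))
  have hc : Commute (shiftOp 1) (NormedSpace.exp (laurentSum shiftOp (timeSeq (-1) (-t₂)))) :=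
    (isBoundedPowers_shiftOp.commute_laurentSum _ _).exp_right
  rw [← mul_assoc, ← hc.eq, mul_assoc] at h
  exact (((BoundedContinuousFunction.evalCLM ℂ n).comp
    (ContinuousLinearMap.apply ℂ (ℤ →ᵇ ℂ) (moment μ))).hasFDerivAt.comp_hasDerivAt _ h)

lemma hasDerivAt_deformedMoment_snd (μ : ComplexMeasure Circle) (t₁ : ℕ+ → ℂ) {t₂ : ℕ+ → ℂ}
    (ht₂ : Summable fun j => ‖t₂ j‖) (n : ℤ) :
    HasDerivAt (fun s => deformedMoment μ t₁ (Function.update t₂ 1 s) n)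
      (-deformedMoment μ t₁ t₂ (n - 1)) (t₂ 1) := by
  have h := (isBoundedPowers_shiftOp.hasDerivAt_exp_neg_update (ε := -1) (by simp) ht₂
    (NormedSpace.exp (laurentSum shiftOp (timeSeq 1 t₁))))
  exact (((BoundedContinuousFunction.evalCLM ℂ n).comp
    (ContinuousLinearMap.apply ℂ (ℤ →ᵇ ℂ) (moment μ))).hasFDerivAt.comp_hasDerivAt _ h)

/-! ### Row-finite and column-finite semi-infinite matrices -/

/-- At most `p` diagonals above the main one are non-zero. -/
def IsLowerBanded (p : ℕ) (A : SMat) : Prop := ∀ i j, i + p < j → A i j = 0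

/-- At most `p` diagonals below the main one are non-zero. -/
def IsUpperBanded (p : ℕ) (A : SMat) : Prop := ∀ i j, j + p < i → A i j = 0

lemma sMul_eq_sum {A B : SMat} {i k : ℕ} (N : ℕ) (h : ∀ j, N ≤ j → A i j * B j k = 0) :
    (A ⊠ B) i k = ∑ j ∈ Finset.range N, A i j * B j k :=
  tsum_eq_sum fun j hj => h j (by simpa using hj)

lemma one_sMul (A : SMat) : 1 ⊠ A = A := by
  ext i k
  rw [sMul, tsum_eq_single i fun j hj => by rw [Matrix.one_apply_ne hj.symm, zero_mul]]
  simp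

lemma sMul_one (A : SMat) : A ⊠ 1 = A := by
  ext i k
  rw [sMul, tsum_eq_single k fun j hj => by rw [Matrix.one_apply_ne hj, mul_zero]]
  simp

lemma neg_sMul (A B : SMat) : (-A) ⊠ B = -(A ⊠ B) := by
  ext i k
  simp [sMul, tsum_neg]

lemma sMul_neg (A B : SMat) : A ⊠ (-B) = -(A ⊠ B) := by
  ext i k
  simp [sMul, tsum_neg]

lemma isUpperBanded_iff {p : ℕ} {A : SMat} : IsUpperBanded p A ↔ IsLowerBanded p A.transpose :=
  ⟨fun h i j hij => h j i hij, fun h i j hij => h j i hij⟩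

namespace IsLowerBanded

variable {p q : ℕ} {A B : SMat}

lemma sMul_eq_sum (hA : IsLowerBanded p A) (B : SMat) {i N : ℕ} (hN : i + p < N) (k : ℕ) :
    (A ⊠ B) i k = ∑ j ∈ Finset.range N, A i j * B j k :=
  OLPUC.sMul_eq_sum N fun j hj => by rw [hA i j (by omega), zero_mul]

lemma sMul (hA : IsLowerBanded p A) (hB : IsLowerBanded q B) :
    IsLowerBanded (p + q) (A ⊠ B) := fun i k h => by
  rw [hA.sMul_eq_sum B (Nat.lt_succ_self _)]
  refine Finset.sum_eq_zero fun j hj => ?_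
  rw [hB j k (by have := Finset.mem_range.1 hj; omega), mul_zero]

lemma assoc (hA : IsLowerBanded p A) (hB : IsLowerBanded q B) (C : SMat) :
    A ⊠ B ⊠ C = A ⊠ (B ⊠ C) := by
  ext i l
  rw [(hA.sMul hB).sMul_eq_sum C (N := i + p + q + 1) (by omega),
    hA.sMul_eq_sum _ (Nat.lt_succ_self _)]
  simp only [hA.sMul_eq_sum B (Nat.lt_succ_self (i + p)), Finset.sum_mul]
  rw [Finset.sum_comm]
  refine Finset.sum_congr rfl fun j hj => ?_
  rw [hB.sMul_eq_sum C (N := i + p + q + 1) (by have := Finset.mem_range.1 hj; omega),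
    Finset.mul_sum]
  simp only [mul_assoc]

/-- Row-finiteness on the left and column-finiteness on the right make both sums finite, so the
middle factor is arbitrary. This lets lower and upper factors be mixed around a full moment matrix.
-/
lemma assoc_upper (hA : IsLowerBanded p A) (B : SMat) {C : SMat} (hC : IsUpperBanded q C) :
    A ⊠ B ⊠ C = A ⊠ (B ⊠ C) := by
  have hC' : ∀ (D : SMat) (i k : ℕ), (D ⊠ C) i k =
      ∑ j ∈ Finset.range (k + q + 1), D i j * C j k := fun D i k =>
    OLPUC.sMul_eq_sum _ fun j hj => by rw [hC j k (by omega), mul_zero]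
  ext i l
  rw [hC', hA.sMul_eq_sum _ (Nat.lt_succ_self _)]
  simp only [hA.sMul_eq_sum B (Nat.lt_succ_self (i + p)), Finset.sum_mul, hC', Finset.mul_sum]
  rw [Finset.sum_comm]
  simp only [mul_assoc]

lemma sMul_add (hA : IsLowerBanded p A) (B C : SMat) : A ⊠ (B + C) = A ⊠ B + A ⊠ C := by
  ext i k
  simp only [Matrix.add_apply, hA.sMul_eq_sum _ (Nat.lt_succ_self (i + p)), mul_add,
    Finset.sum_add_distrib]

lemma add (hA : IsLowerBanded p A) (hB : IsLowerBanded q B) : IsLowerBanded (p + q) (A + B) :=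
  fun i j h => by rw [Matrix.add_apply, hA i j (by omega), hB i j (by omega), add_zero]

lemma add_sMul (hA : IsLowerBanded p A) (hB : IsLowerBanded q B) (C : SMat) :
    (A + B) ⊠ C = A ⊠ C + B ⊠ C := by
  ext i k
  rw [Matrix.add_apply, (hA.add hB).sMul_eq_sum C (Nat.lt_succ_self _),
    hA.sMul_eq_sum C (N := i + (p + q) + 1) (by omega),
    hB.sMul_eq_sum C (N := i + (p + q) + 1) (by omega), ← Finset.sum_add_distrib]
  simp only [Matrix.add_apply, add_mul]

end IsLowerBanded

lemma IsUpperBanded.add_sMul {p : ℕ} {C : SMat} (hC : IsUpperBanded p C) (A B : SMat) :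
    (A + B) ⊠ C = A ⊠ C + B ⊠ C := by
  apply Matrix.transpose_injective
  simp only [transpose_sMul, Matrix.transpose_add]
  exact (isUpperBanded_iff.1 hC).sMul_add _ _

/-- A class of semi-infinite matrices which is a ring for the product `⊠`. -/
structure IsMatrixRing (P : SMat → Prop) : Prop where
  mul : ∀ {A B}, P A → P B → P (A ⊠ B)
  neg : ∀ {A}, P A → P (-A)
  assoc : ∀ {A B C}, P A → P B → P C → A ⊠ B ⊠ C = A ⊠ (B ⊠ C)
  mul_add : ∀ {A B C}, P A → P B → P C → A ⊠ (B + C) = A ⊠ B + A ⊠ C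
  add_mul : ∀ {A B C}, P A → P B → P C → (A + B) ⊠ C = A ⊠ C + B ⊠ C

lemma isMatrixRing_lowerBanded : IsMatrixRing fun A => ∃ p, IsLowerBanded p A where
  mul := fun ⟨_, hA⟩ ⟨_, hB⟩ => ⟨_, hA.sMul hB⟩
  neg := fun ⟨p, hA⟩ => ⟨p, fun i j h => by rw [Matrix.neg_apply, hA i j h, neg_zero]⟩
  assoc := fun ⟨_, hA⟩ ⟨_, hB⟩ _ => hA.assoc hB _
  mul_add := fun ⟨_, hA⟩ _ _ => hA.sMul_add _ _
  add_mul := fun ⟨_, hA⟩ ⟨_, hB⟩ _ => hA.add_sMul hB _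

lemma IsMatrixRing.transpose {P : SMat → Prop} (hP : IsMatrixRing P) :
    IsMatrixRing fun A => P A.transpose where
  mul hA hB := by simpa only [transpose_sMul] using hP.mul hB hA
  neg hA := by simpa using hP.neg hA
  assoc hA hB hC := Matrix.transpose_injective <| by
    simpa only [transpose_sMul] using (hP.assoc hC hB hA).symm
  mul_add hA hB hC := Matrix.transpose_injective <| by
    simpa only [transpose_sMul, Matrix.transpose_add] using hP.add_mul hB hC hA
  add_mul hA hB hC := Matrix.transpose_injective <| by
    simpa only [transpose_sMul, Matrix.transpose_add] using hP.mul_add hC hA hB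

lemma isMatrixRing_upperBanded : IsMatrixRing fun A => ∃ p, IsUpperBanded p A := by
  simpa only [isUpperBanded_iff] using isMatrixRing_lowerBanded.transpose

/-- The derivative of a conjugate `A Y A⁻¹`, for `X = A' A⁻¹`. -/
lemma IsMatrixRing.conj_deriv {P : SMat → Prop} (hP : IsMatrixRing P) {A I A' I' Y : SMat}
    (hA : P A) (hI : P I) (hA' : P A') (hI' : P I') (hY : P Y) (h1 : I ⊠ A = 1)
    (h2 : A' ⊠ I + A ⊠ I' = 0) :
    A' = A' ⊠ I ⊠ A ∧ I' = -(I ⊠ (A' ⊠ I)) ∧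
      A' ⊠ Y ⊠ I + A ⊠ Y ⊠ I' = sComm (A' ⊠ I) (A ⊠ Y ⊠ I) := by
  have e1 : A' = A' ⊠ I ⊠ A := by rw [hP.assoc hA' hI hA, h1, sMul_one]
  have e2 : I' = -(I ⊠ (A' ⊠ I)) := by
    rw [← sMul_neg, ← eq_neg_of_add_eq_zero_right h2, ← hP.assoc hI hA hI', h1, one_sMul]
  refine ⟨e1, e2, ?_⟩
  have hX := hP.mul hA' hI
  rw [sComm, sub_eq_add_neg]
  congr 1
  · conv_lhs => rw [e1]
    rw [hP.assoc hX hA hY, hP.assoc hX (hP.mul hA hY) hI]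
  · rw [e2, sMul_neg, hP.assoc (hP.mul hA hY) hI hX]

/-! ### Entrywise derivatives -/

/-- The entries of `A` have the derivatives `A'` at `s₀`. -/
def HasEntryDeriv (A : ℂ → SMat) (A' : SMat) (s₀ : ℂ) : Prop :=
  ∀ i j, HasDerivAt (fun s => A s i j) (A' i j) s₀

lemma HasEntryDeriv.sMul_lower {A B : ℂ → SMat} {A' B' : SMat} {s₀ : ℂ} {p : ℕ}
    (hA : HasEntryDeriv A A' s₀) (hB : HasEntryDeriv B B' s₀) (h : ∀ s, IsLowerBanded p (A s))
    (h' : IsLowerBanded p A') :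
    HasEntryDeriv (fun s => A s ⊠ B s) (A' ⊠ B s₀ + A s₀ ⊠ B') s₀ := fun i k => by
  simp only [Matrix.add_apply, (h _).sMul_eq_sum _ (Nat.lt_succ_self (i + p)),
    h'.sMul_eq_sum _ (Nat.lt_succ_self (i + p)), ← Finset.sum_add_distrib]
  exact HasDerivAt.fun_sum fun j _ => (hA i j).mul (hB j k)

lemma HasEntryDeriv.transpose {A : ℂ → SMat} {A' : SMat} {s₀ : ℂ} (h : HasEntryDeriv A A' s₀) :
    HasEntryDeriv (fun s => (A s).transpose) A'.transpose s₀ := fun i j => h j i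

lemma HasEntryDeriv.sMul_upper {A B : ℂ → SMat} {A' B' : SMat} {s₀ : ℂ} {p : ℕ}
    (hA : HasEntryDeriv A A' s₀) (hB : HasEntryDeriv B B' s₀) (h : ∀ s, IsUpperBanded p (B s))
    (h' : IsUpperBanded p B') :
    HasEntryDeriv (fun s => A s ⊠ B s) (A' ⊠ B s₀ + A s₀ ⊠ B') s₀ := by
  have := (hB.transpose.sMul_lower hA.transpose (fun s => isUpperBanded_iff.1 (h s))
    (isUpperBanded_iff.1 h')).transpose
  simpa only [← transpose_sMul, Matrix.transpose_transpose, Matrix.transpose_add, add_comm]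
    using this

lemma HasEntryDeriv.const (A : SMat) (s₀ : ℂ) : HasEntryDeriv (fun _ => A) 0 s₀ :=
  fun _ _ => hasDerivAt_const _ _

section Differentiability

variable {n : Type*} [Fintype n] [DecidableEq n] {M : ℂ → Matrix n n ℂ} {s₀ : ℂ}

lemma differentiableAt_det (h : ∀ i j, DifferentiableAt ℂ (fun s => M s i j) s₀) :
    DifferentiableAt ℂ (fun s => (M s).det) s₀ := by
  simp only [Matrix.det_apply]
  exact DifferentiableAt.fun_sum fun σ _ =>
    (DifferentiableAt.fun_finsetProd fun i _ => h _ _).const_smul _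

lemma differentiableAt_inv (h : ∀ i j, DifferentiableAt ℂ (fun s => M s i j) s₀)
    (hd : (M s₀).det ≠ 0) (i j : n) : DifferentiableAt ℂ (fun s => (M s)⁻¹ i j) s₀ := by
  simp only [Matrix.inv_def, Ring.inverse_eq_inv', Matrix.smul_apply, smul_eq_mul,
    Matrix.adjugate_apply]
  refine ((differentiableAt_det h).inv hd).mul (differentiableAt_det fun a b => ?_)
  simp only [Matrix.updateRow_apply]
  split_ifs
  · exact differentiableAt_const _
  · exact h a b

end Differentiability

/-! ### The Gauss–Borel factors of a quasi-definite matrix -/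

lemma isLowerBanded_S1 (G : SMat) : IsLowerBanded 0 (S1 G) := fun i j h => S1_lower G i j h

lemma isLowerBanded_lowerInv (A : SMat) : IsLowerBanded 0 (lowerInv A) := fun i j h => by
  rw [lowerInv, dif_neg (by omega)]

lemma isUpperBanded_upperInv (A : SMat) : IsUpperBanded 0 (upperInv A) := fun i j h => by
  rw [upperInv, dif_neg (by omega)]

lemma isUpperBanded_S2 {G : SMat} (hG : QuasiDefinite G) : IsUpperBanded 0 (S2 G) :=
  fun i j h => S2_upper hG i j h

/-- The row-by-row form, asking for one minor only, is what remains usable at nearby parameters,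
where full quasi-definiteness may fail. -/
lemma S2_upper_of_det_ne_zero {G : SMat} {l : ℕ} (hl : (trunc G l).det ≠ 0) {k : ℕ} (h : k < l) :
    S2 G l k = 0 := by
  have e : ∑ j : Fin l, S1 G l j * G j k =
      -∑ i : Fin l, G l i * ∑ j : Fin l, (trunc G l)⁻¹ i j * trunc G l j ⟨k, h⟩ := by
    simp only [S1, Fin.is_lt, dif_pos, neg_mul, Finset.sum_neg_distrib, Finset.sum_mul,
      Finset.mul_sum, trunc, Fin.eta]
    rw [Finset.sum_comm]
    simp only [mul_assoc]
  have this : ∀ i : Fin l, ∑ j : Fin l, (trunc G l)⁻¹ i j * trunc G l j ⟨k, h⟩ =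
      if i = ⟨k, h⟩ then 1 else 0 := fun i => by
    rw [← Matrix.mul_apply, Matrix.nonsing_inv_mul _ hl.isUnit, Matrix.one_apply]
  rw [S2_apply, e]
  simp [this]

lemma S2_diag_ne_zero {G : SMat} (hG : QuasiDefinite G) (i : ℕ) : S2 G i i ≠ 0 :=
  ((isGaussBorel_iff hG _ _).2 ⟨rfl, rfl⟩).diag_ne i

lemma det_trunc_S2 (G : SMat) (n : ℕ) : (trunc (S2 G) n).det = (trunc G n).det := by
  rw [S2, trunc_sMul (S1_lower G), Matrix.det_mul, det_trunc_lower (S1_lower G)]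
  simp [S1_diag]

lemma S1_sMul_lowerInv (G : SMat) : S1 G ⊠ lowerInv (S1 G) = 1 :=
  (lowerInv_spec (S1_lower G) fun i => by simp [S1_diag]).1

lemma lowerInv_sMul_S1 (G : SMat) : lowerInv (S1 G) ⊠ S1 G = 1 :=
  (lowerInv_spec (S1_lower G) fun i => by simp [S1_diag]).2

lemma S2_sMul_upperInv {G : SMat} (hG : QuasiDefinite G) : S2 G ⊠ upperInv (S2 G) = 1 :=
  (upperInv_spec (S2_upper hG) (S2_diag_ne_zero hG)).1

lemma upperInv_sMul_S2 {G : SMat} (hG : QuasiDefinite G) : upperInv (S2 G) ⊠ S2 G = 1 :=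
  (upperInv_spec (S2_upper hG) (S2_diag_ne_zero hG)).2

lemma isLowerBanded_Upsilon : IsLowerBanded 2 Upsilon := fun i j h => by
  simp only [Upsilon, Matrix.add_apply, Lambda1, Lambda2, Matrix.transpose_apply, E10]
  rw [if_neg (by omega), if_neg (by omega), if_neg (by omega)]
  simp

lemma isUpperBanded_Upsilon : IsUpperBanded 2 Upsilon := fun i j h => by
  simp only [Upsilon, Matrix.add_apply, Lambda1, Lambda2, Matrix.transpose_apply, E10]
  rw [if_neg (by omega), if_neg (by omega), if_neg (by omega)]
  simp

lemma isUpperBanded_Upsilon_transpose : IsUpperBanded 2 Upsilon.transpose :=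
  fun i j h => isLowerBanded_Upsilon j i h

lemma isLowerBanded_Upsilon_transpose : IsLowerBanded 2 Upsilon.transpose :=
  fun i j h => isUpperBanded_Upsilon j i h

lemma isLowerBanded_L1 (G : SMat) : IsLowerBanded 2 (L1 G) := by
  simpa using! ((isLowerBanded_S1 G).sMul isLowerBanded_Upsilon).sMul
    (isLowerBanded_lowerInv (S1 G))

lemma IsUpperBanded.sMul {p q : ℕ} {A B : SMat} (hA : IsUpperBanded p A)
    (hB : IsUpperBanded q B) : IsUpperBanded (p + q) (A ⊠ B) := by
  rw [isUpperBanded_iff, transpose_sMul, add_comm]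
  exact (isUpperBanded_iff.1 hB).sMul (isUpperBanded_iff.1 hA)

lemma isUpperBanded_L2 {G : SMat} (hG : QuasiDefinite G) : IsUpperBanded 2 (L2 G) := by
  simpa using! ((isUpperBanded_S2 hG).sMul isUpperBanded_Upsilon_transpose).sMul
    (isUpperBanded_upperInv (S2 G))

lemma sMul_zero (A : SMat) : A ⊠ (0 : SMat) = 0 := by
  ext i j
  simp [OLPUC.sMul]

/-! ### Derivatives of the factors -/

lemma differentiableAt_trunc_inv {A : ℂ → SMat} {s₀ : ℂ} {n : ℕ}
    (h : ∀ i j, DifferentiableAt ℂ (fun s => A s i j) s₀) (hd : (trunc (A s₀) n).det ≠ 0)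
    (i j : Fin n) : DifferentiableAt ℂ (fun s => (trunc (A s) n)⁻¹ i j) s₀ :=
  differentiableAt_inv (M := fun s => trunc (A s) n) (fun a b => h a b) hd i j

section Factors

variable {Γ : ℂ → SMat} {D : SMat} {s₀ : ℂ}

lemma eventually_det_ne_zero (hΓ : HasEntryDeriv Γ D s₀) (hG : QuasiDefinite (Γ s₀)) (n : ℕ) :
    ∀ᶠ s in nhds s₀, (trunc (Γ s) n).det ≠ 0 :=
  (differentiableAt_det (M := fun s => trunc (Γ s) n) fun i j =>
    (hΓ i j).differentiableAt).continuousAt.eventually_ne (hG n)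

lemma differentiableAt_S1 (hΓ : HasEntryDeriv Γ D s₀) (hG : QuasiDefinite (Γ s₀)) (i j : ℕ) :
    DifferentiableAt ℂ (fun s => S1 (Γ s) i j) s₀ := by
  simp only [S1]
  split_ifs with h1 h2
  · exact (DifferentiableAt.fun_sum fun k _ => (hΓ _ _).differentiableAt.mul
      (differentiableAt_trunc_inv (fun a b => (hΓ a b).differentiableAt) (hG i) _ _)).fun_neg
  · exact differentiableAt_const _
  · exact differentiableAt_const _

lemma differentiableAt_S2 (hΓ : HasEntryDeriv Γ D s₀) (hG : QuasiDefinite (Γ s₀)) (i j : ℕ) :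
    DifferentiableAt ℂ (fun s => S2 (Γ s) i j) s₀ := by
  simp only [S2_apply]
  exact (DifferentiableAt.fun_sum fun k _ => (differentiableAt_S1 hΓ hG _ _).mul
    (hΓ _ _).differentiableAt).fun_add (hΓ _ _).differentiableAt

lemma differentiableAt_lowerInv (hΓ : HasEntryDeriv Γ D s₀) (hG : QuasiDefinite (Γ s₀))
    (i j : ℕ) : DifferentiableAt ℂ (fun s => lowerInv (S1 (Γ s)) i j) s₀ := by
  simp only [lowerInv]
  split_ifs
  · refine differentiableAt_trunc_inv (fun a b => differentiableAt_S1 hΓ hG _ _) ?_ _ _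
    rw [det_trunc_lower (S1_lower _)]
    simp [S1_diag]
  · exact differentiableAt_const _

lemma differentiableAt_upperInv (hΓ : HasEntryDeriv Γ D s₀) (hG : QuasiDefinite (Γ s₀))
    (i j : ℕ) : DifferentiableAt ℂ (fun s => upperInv (S2 (Γ s)) i j) s₀ := by
  simp only [upperInv]
  split_ifs
  · refine differentiableAt_trunc_inv (fun a b => differentiableAt_S2 hΓ hG _ _) ?_ _ _
    rw [det_trunc_S2]
    exact hG _
  · exact differentiableAt_const _

/-- The entrywise derivative of a family of semi-infinite matrices. -/
noncomputable def entryDeriv (A : ℂ → SMat) (s₀ : ℂ) : SMat :=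
  fun i j => deriv (fun s => A s i j) s₀

lemma isLowerBanded_entryDeriv {A : ℂ → SMat} {p : ℕ} (h : ∀ s, IsLowerBanded p (A s)) (s₀ : ℂ) :
    IsLowerBanded p (entryDeriv A s₀) := fun i j hij => by
  simp [entryDeriv, fun s => h s i j hij]

lemma isUpperBanded_entryDeriv {A : ℂ → SMat} {p : ℕ} (h : ∀ s, IsUpperBanded p (A s)) (s₀ : ℂ) :
    IsUpperBanded p (entryDeriv A s₀) := fun i j hij => by
  simp [entryDeriv, fun s => h s i j hij]

lemma HasEntryDeriv.unique {A : ℂ → SMat} {A' A'' : SMat} (h : HasEntryDeriv A A' s₀)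
    (h' : HasEntryDeriv A A'' s₀) : A' = A'' := by
  ext i j
  exact (h i j).unique (h' i j)

lemma eventually_S2_upper (hΓ : HasEntryDeriv Γ D s₀) (hG : QuasiDefinite (Γ s₀)) (i : ℕ) :
    ∀ᶠ s in nhds s₀, ∀ j, j < i → S2 (Γ s) i j = 0 :=
  (eventually_det_ne_zero hΓ hG i).mono fun _ hs _ hj => S2_upper_of_det_ne_zero hs hj

lemma eventually_S2_sMul_upperInv (hΓ : HasEntryDeriv Γ D s₀) (hG : QuasiDefinite (Γ s₀))
    (i k : ℕ) : ∀ᶠ s in nhds s₀, (S2 (Γ s) ⊠ upperInv (S2 (Γ s))) i k = (1 : SMat) i k := by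
  filter_upwards [eventually_S2_upper hΓ hG i, eventually_det_ne_zero hΓ hG (k + 1)] with s h1 h2
  rw [sMul_upper (B := upperInv (S2 (Γ s))) (isUpperBanded_upperInv _)]
  rcases lt_or_ge k i with hik | hik
  · rw [Matrix.one_apply_ne (by omega)]
    refine Finset.sum_eq_zero fun j hj => ?_
    rw [h1 j (by have := Finset.mem_range.1 hj; omega), zero_mul]
  · rw [← det_trunc_S2] at h2
    have key := congrFun (congrFun (Matrix.mul_nonsing_inv (trunc (S2 (Γ s)) (k + 1)) h2.isUnit)
      ⟨i, Nat.lt_succ_of_le hik⟩) ⟨k, Nat.lt_succ_self _⟩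
    rw [Matrix.mul_apply, Matrix.one_apply] at key
    rw [Finset.sum_range]
    simpa [upperInv, trunc, Nat.lt_succ_iff, Fin.is_le, Fin.ext_iff, Matrix.one_apply] using key

/-- The derivatives of the Gauss–Borel factors and of the Lax matrices along a curve of moment
matrices, in terms of `X = S₁' S₁⁻¹` and `Z = S₂' S₂⁻¹`. -/
lemma exists_factor_derivs (hΓ : HasEntryDeriv Γ D s₀) (hG : QuasiDefinite (Γ s₀)) :
    ∃ X Z : SMat, (∀ i j, i ≤ j → X i j = 0) ∧ IsUpperBanded 0 Z ∧
      X + S1 (Γ s₀) ⊠ D ⊠ upperInv (S2 (Γ s₀)) = Z ∧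
      HasEntryDeriv (fun s => S1 (Γ s)) (X ⊠ S1 (Γ s₀)) s₀ ∧
      HasEntryDeriv (fun s => S2 (Γ s)) (Z ⊠ S2 (Γ s₀)) s₀ ∧
      HasEntryDeriv (fun s => upperInv (S2 (Γ s))) (-(upperInv (S2 (Γ s₀)) ⊠ Z)) s₀ ∧
      HasEntryDeriv (fun s => L1 (Γ s)) (sComm X (L1 (Γ s₀))) s₀ ∧
      HasEntryDeriv (fun s => L2 (Γ s)) (sComm Z (L2 (Γ s₀))) s₀ := by
  set S := S1 (Γ s₀) with hS
  set T := S2 (Γ s₀) with hT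
  set I := lowerInv S with hI
  set V := upperInv T with hV
  set dS := entryDeriv (fun s => S1 (Γ s)) s₀ with hdS
  set dT := entryDeriv (fun s => S2 (Γ s)) s₀ with hdT
  set dI := entryDeriv (fun s => lowerInv (S1 (Γ s))) s₀ with hdI
  set dV := entryDeriv (fun s => upperInv (S2 (Γ s))) s₀ with hdV
  have DS : HasEntryDeriv (fun s => S1 (Γ s)) dS s₀ := fun i j =>
    (differentiableAt_S1 hΓ hG i j).hasDerivAt
  have DT : HasEntryDeriv (fun s => S2 (Γ s)) dT s₀ := fun i j =>
    (differentiableAt_S2 hΓ hG i j).hasDerivAt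
  have DI : HasEntryDeriv (fun s => lowerInv (S1 (Γ s))) dI s₀ := fun i j =>
    (differentiableAt_lowerInv hΓ hG i j).hasDerivAt
  have DV : HasEntryDeriv (fun s => upperInv (S2 (Γ s))) dV s₀ := fun i j =>
    (differentiableAt_upperInv hΓ hG i j).hasDerivAt
  have bS : IsLowerBanded 0 S := isLowerBanded_S1 _
  have bI : IsLowerBanded 0 I := isLowerBanded_lowerInv _
  have bT : IsUpperBanded 0 T := isUpperBanded_S2 hG
  have bV : IsUpperBanded 0 V := isUpperBanded_upperInv _
  have bdS : IsLowerBanded 0 dS := isLowerBanded_entryDeriv (fun s => isLowerBanded_S1 _) _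
  have bdI : IsLowerBanded 0 dI := isLowerBanded_entryDeriv (fun s => isLowerBanded_lowerInv _) _
  have bdV : IsUpperBanded 0 dV := isUpperBanded_entryDeriv (fun s => isUpperBanded_upperInv _) _
  -- `S₂` need not be upper triangular away from `s₀`, but each single entry below the diagonal
  -- vanishes near `s₀`.
  have bdT : IsUpperBanded 0 dT := fun i j hij =>
    (DT i j).unique ((hasDerivAt_const s₀ (0 : ℂ)).congr_of_eventuallyEq
      ((eventually_S2_upper hΓ hG i).mono fun s hs => hs j hij))
  have dS_diag : ∀ i, dS i i = 0 := fun i => by simp [hdS, entryDeriv, S1_diag]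
  have r1 : dS ⊠ Γ s₀ + S ⊠ D = dT :=
    (DS.sMul_lower hΓ (fun s => isLowerBanded_S1 _) bdS).unique DT
  have r2 : dS ⊠ I + S ⊠ dI = 0 := by
    refine (DS.sMul_lower DI (fun s => isLowerBanded_S1 _) bdS).unique ?_
    simp only [S1_sMul_lowerInv]
    exact HasEntryDeriv.const 1 s₀
  have r3 : dT ⊠ V + T ⊠ dV = 0 := by
    -- The product is cut off by the right factor: `upperInv` is upper triangular for every `s` by
    -- definition, whereas `S₂` is not known to be.
    have h := DT.sMul_upper DV (fun s => isUpperBanded_upperInv _) bdV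
    ext i j
    exact (h i j).unique ((hasDerivAt_const s₀ ((1 : SMat) i j)).congr_of_eventuallyEq
      (eventually_S2_sMul_upperInv hΓ hG i j))
  have IS : I ⊠ S = 1 := lowerInv_sMul_S1 _
  have VT : V ⊠ T = 1 := upperInv_sMul_S2 hG
  have TV : T ⊠ V = 1 := S2_sMul_upperInv hG
  obtain ⟨a1, a2, a3⟩ := isMatrixRing_lowerBanded.conj_deriv ⟨0, bS⟩ ⟨0, bI⟩ ⟨0, bdS⟩ ⟨0, bdI⟩
    ⟨2, isLowerBanded_Upsilon⟩ IS r2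
  obtain ⟨b1, b2, b3⟩ := isMatrixRing_upperBanded.conj_deriv ⟨0, bT⟩ ⟨0, bV⟩ ⟨0, bdT⟩ ⟨0, bdV⟩
    ⟨2, isUpperBanded_Upsilon_transpose⟩ VT r3
  have bX : IsLowerBanded 0 (dS ⊠ I) := bdS.sMul bI
  refine ⟨dS ⊠ I, dT ⊠ V, fun i j hij => ?_, bdT.sMul bV, ?_, a1 ▸ DS, b1 ▸ DT, b2 ▸ DV, ?_, ?_⟩
  · rcases hij.lt_or_eq with h | rfl
    · exact bX i j h
    -- The diagonal of `S₁` is constantly `1`, so `S₁'` is strictly lower triangular, and so is `X`.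
    · rw [bdS.sMul_eq_sum I (Nat.lt_succ_self _)]
      refine Finset.sum_eq_zero fun k hk => ?_
      rcases (Finset.mem_range_succ_iff.1 hk).lt_or_eq with h | h
      · rw [bI k i (by omega), mul_zero]
      · rw [h, dS_diag, zero_mul]
  · rw [← r1, bV.add_sMul]
    congr 1
    conv_rhs => rw [a1]
    -- `S₁' G S₂⁻¹ = X S₁ G S₂⁻¹ = X S₂ S₂⁻¹ = X`.
    rw [bX.assoc bS, show S ⊠ Γ s₀ = T from rfl, bX.assoc_upper _ bV, TV, sMul_one]
  · rw [show L1 (Γ s₀) = S ⊠ Upsilon ⊠ I from rfl, ← a3]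
    have h := DS.sMul_lower (HasEntryDeriv.const Upsilon s₀) (fun s => isLowerBanded_S1 _) bdS
    simp only [sMul_zero, add_zero] at h
    exact h.sMul_lower DI (fun s => (isLowerBanded_S1 _).sMul isLowerBanded_Upsilon)
      (bdS.sMul isLowerBanded_Upsilon)
  · rw [show L2 (Γ s₀) = T ⊠ Upsilon.transpose ⊠ V from rfl, ← b3]
    have h := DT.sMul_upper (HasEntryDeriv.const Upsilon.transpose s₀)
      (fun s => isUpperBanded_Upsilon_transpose) (p := 2) (fun _ _ _ => rfl)
    simp only [sMul_zero, add_zero] at h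
    exact h.sMul_upper DV (fun s => isUpperBanded_upperInv _) bdV

end Factors

/-! ### The shift matrix as a permutation matrix -/

/-- The permutation of the CMV indices induced by multiplication by `z`. -/
noncomputable def cmvSucc : Equiv.Perm ℕ :=
  (cmvEquiv.trans (Equiv.addRight (1 : ℤ))).trans cmvEquiv.symm

lemma cmvExp_cmvSucc (i : ℕ) : cmvExp (cmvSucc i) = cmvExp i + 1 :=
  cmvEquiv.apply_symm_apply (cmvExp i + 1)

lemma cmvSucc_eq_iff {i j : ℕ} : cmvSucc i = j ↔ cmvExp j = cmvExp i + 1 := by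
  rw [← cmvExp_cmvSucc, cmvExp_bijective.1.eq_iff, eq_comm]

lemma Upsilon_apply' (i j : ℕ) : Upsilon i j = if cmvSucc i = j then 1 else 0 := by
  rw [Upsilon_apply]
  exact if_congr cmvSucc_eq_iff.symm rfl rfl

lemma Upsilon_sMul (A : SMat) (i k : ℕ) : (Upsilon ⊠ A) i k = A (cmvSucc i) k := by
  rw [sMul, tsum_eq_single (cmvSucc i) fun j hj => by
    rw [Upsilon_apply', if_neg hj.symm, zero_mul]]
  simp [Upsilon_apply']

lemma sMul_Upsilon (A : SMat) (i k : ℕ) : (A ⊠ Upsilon) i k = A i (cmvSucc.symm k) := by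
  rw [sMul, tsum_eq_single (cmvSucc.symm k) fun j hj => by
    rw [Upsilon_apply', if_neg fun h => hj (by rw [← h, Equiv.symm_apply_apply]), mul_zero]]
  simp [Upsilon_apply']

lemma Upsilon_transpose_sMul (A : SMat) (i k : ℕ) :
    (Upsilon.transpose ⊠ A) i k = A (cmvSucc.symm i) k := by
  have := sMul_Upsilon A.transpose k i
  rwa [← Matrix.transpose_apply (A.transpose ⊠ Upsilon), transpose_sMul] at this

lemma sMul_Upsilon_transpose (A : SMat) (i k : ℕ) :
    (A ⊠ Upsilon.transpose) i k = A i (cmvSucc k) := by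
  have := Upsilon_sMul A.transpose k i
  rwa [← Matrix.transpose_apply (Upsilon ⊠ A.transpose), transpose_sMul] at this

lemma cmvSucc_even (m : ℕ) : cmvSucc (2 * m) = 2 * m + 2 := by
  rw [cmvSucc_eq_iff, show 2 * m + 2 = 2 * (m + 1) by ring, cmvExp_even, cmvExp_even]
  push_cast
  ring

lemma cmvSucc_one : cmvSucc 1 = 0 := by
  rw [cmvSucc_eq_iff]
  simp [cmvExp]

lemma cmvSucc_odd (m : ℕ) : cmvSucc (2 * m + 3) = 2 * m + 1 := by
  rw [cmvSucc_eq_iff, show 2 * m + 3 = 2 * (m + 1) + 1 by ring, cmvExp_odd, cmvExp_odd]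
  push_cast
  ring

lemma cmvSucc_symm_even (m : ℕ) : cmvSucc.symm (2 * m + 2) = 2 * m := by
  rw [Equiv.symm_apply_eq, cmvSucc_even]

lemma cmvSucc_symm_odd (m : ℕ) : cmvSucc.symm (2 * m + 1) = 2 * m + 3 := by
  rw [Equiv.symm_apply_eq, cmvSucc_odd]

lemma cmvSucc_symm_zero : cmvSucc.symm 0 = 1 := by
  rw [Equiv.symm_apply_eq, cmvSucc_one]

/-! ### Moment matrices of CMV type -/

/-- Moment matrices `∮ χ χ† dμ`: the entries depend on the difference of the CMV exponents. -/
def IsCMVMoment (c : ℤ → ℂ) (G : SMat) : Prop := ∀ i j, G i j = c (cmvExp i - cmvExp j)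

section Gauss

variable {c : ℤ → ℂ} {G : SMat}

/-- The string equation: raising the row exponent by one or lowering the column exponent by one has
the same effect on the difference. -/
lemma IsCMVMoment.Upsilon_comm (hc : IsCMVMoment c G) : Upsilon ⊠ G = G ⊠ Upsilon := by
  ext i j
  rw [Upsilon_sMul, sMul_Upsilon, hc, hc, cmvExp_cmvSucc]
  have := cmvExp_cmvSucc (cmvSucc.symm j)
  rw [Equiv.apply_symm_apply] at this
  rw [this]
  congr 1
  ring

lemma IsCMVMoment.Upsilon_transpose_comm (hc : IsCMVMoment c G) :
    Upsilon.transpose ⊠ G = G ⊠ Upsilon.transpose := by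
  ext i j
  rw [Upsilon_transpose_sMul, sMul_Upsilon_transpose, hc, hc, cmvExp_cmvSucc]
  have := cmvExp_cmvSucc (cmvSucc.symm i)
  rw [Equiv.apply_symm_apply] at this
  rw [this]
  congr 1
  ring

/-- `S₁ Y G S₂⁻¹ = S₁ Y S₁⁻¹`. -/
lemma S1_conj (hG : QuasiDefinite G) {Y : SMat} {p : ℕ} (hY : IsLowerBanded p Y) :
    S1 G ⊠ (Y ⊠ G) ⊠ upperInv (S2 G) = S1 G ⊠ Y ⊠ lowerInv (S1 G) := by
  have bS := isLowerBanded_S1 G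
  have bI := isLowerBanded_lowerInv (S1 G)
  have bV := isUpperBanded_upperInv (S2 G)
  have bSY := bS.sMul hY
  have e : S1 G ⊠ (Y ⊠ G) = S1 G ⊠ Y ⊠ lowerInv (S1 G) ⊠ S2 G := by
    rw [S2, bSY.assoc bI, ← bI.assoc bS, lowerInv_sMul_S1, one_sMul, bS.assoc hY]
  rw [e, (bSY.sMul bI).assoc_upper _ bV, S2_sMul_upperInv hG, sMul_one]

/-- `S₁ G Y S₂⁻¹ = S₂ Y S₂⁻¹`. -/
lemma S2_conj {Y : SMat} {p : ℕ} (hY : IsUpperBanded p Y) :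
    S1 G ⊠ (G ⊠ Y) ⊠ upperInv (S2 G) = S2 G ⊠ Y ⊠ upperInv (S2 G) := by
  rw [← (isLowerBanded_S1 G).assoc_upper _ hY]
  rfl

/-- Both sides equal `S₁ Υ G S₂⁻¹ = S₁ G Υ S₂⁻¹`. The form with `S₂` makes the subdiagonal
accessible. -/
lemma L1_eq (hG : QuasiDefinite G) (hc : IsCMVMoment c G) :
    L1 G = S2 G ⊠ Upsilon ⊠ upperInv (S2 G) := by
  rw [← S2_conj isUpperBanded_Upsilon, ← hc.Upsilon_comm, S1_conj hG isLowerBanded_Upsilon]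
  rfl

lemma L2_eq (hG : QuasiDefinite G) (hc : IsCMVMoment c G) :
    L2 G = S1 G ⊠ Upsilon.transpose ⊠ lowerInv (S1 G) := by
  rw [← S1_conj hG isLowerBanded_Upsilon_transpose, hc.Upsilon_transpose_comm,
    S2_conj isUpperBanded_Upsilon_transpose]
  rfl

/-! ### The entries of the Lax matrices next to the diagonal -/

lemma lowerInv_S1_diag (G : SMat) (n : ℕ) : lowerInv (S1 G) n n = 1 := by
  have h := congrFun (congrFun (S1_sMul_lowerInv G) n) n
  rw [sMul_lower (S1_lower G), Finset.sum_range_succ, S1_diag, one_mul, Matrix.one_apply_eq,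
    Finset.sum_eq_zero, zero_add] at h
  · exact h
  · intro j hj
    rw [isLowerBanded_lowerInv _ j n (by simpa using hj), mul_zero]

lemma lowerInv_S1_subdiag (G : SMat) (n : ℕ) :
    lowerInv (S1 G) (n + 1) n = -S1 G (n + 1) n := by
  have h := congrFun (congrFun (S1_sMul_lowerInv G) (n + 1)) n
  rw [sMul_lower (S1_lower G), Finset.sum_range_succ, Finset.sum_range_succ, S1_diag, one_mul,
    lowerInv_S1_diag, mul_one, Matrix.one_apply_ne (by omega), Finset.sum_eq_zero, zero_add] at h
  · exact eq_neg_of_add_eq_zero_right h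
  · intro j hj
    rw [isLowerBanded_lowerInv _ j n (by simpa using hj), mul_zero]

/-- Row `n` of `A` stops at column `n + 2` and column `n + 1` of the inverse starts at row `n + 1`:
two terms overlap. -/
lemma sMul_lowerInv_superdiag {A : SMat} (hA : IsLowerBanded 2 A) (G : SMat) (n : ℕ) :
    (A ⊠ lowerInv (S1 G)) n (n + 1) = A n (n + 1) - A n (n + 2) * S1 G (n + 2) (n + 1) := by
  rw [hA.sMul_eq_sum _ (Nat.lt_succ_self _), Finset.sum_range_succ, Finset.sum_range_succ,
    lowerInv_S1_diag, lowerInv_S1_subdiag, Finset.sum_eq_zero]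
  · ring
  · intro j hj
    rw [isLowerBanded_lowerInv _ j (n + 1) (by simpa using hj), mul_zero]

lemma upperInv_S2_diag (hG : QuasiDefinite G) (n : ℕ) :
    upperInv (S2 G) n n = (S2 G n n)⁻¹ := by
  have h := congrFun (congrFun (S2_sMul_upperInv hG) n) n
  rw [sMul_upper (B := upperInv (S2 G)) (isUpperBanded_upperInv _), Finset.sum_range_succ,
    Matrix.one_apply_eq, Finset.sum_eq_zero, zero_add] at h
  · exact eq_inv_of_mul_eq_one_right h
  · intro j hj
    rw [S2_upper hG n j (by simpa using hj), zero_mul]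

lemma upperInv_S2_superdiag (hG : QuasiDefinite G) (n : ℕ) :
    S2 G n n * (S2 G (n + 1) (n + 1) * upperInv (S2 G) n (n + 1)) = -S2 G n (n + 1) := by
  have h := congrFun (congrFun (S2_sMul_upperInv hG) n) (n + 1)
  rw [sMul_upper (B := upperInv (S2 G)) (isUpperBanded_upperInv _), Finset.sum_range_succ,
    Finset.sum_range_succ, Matrix.one_apply_ne (by omega), Finset.sum_eq_zero, zero_add,
    upperInv_S2_diag hG] at h
  · have h0 := S2_diag_ne_zero hG (n + 1)
    field_simp at h
    linear_combination h
  · intro j hj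
    rw [S2_upper hG n j (by simpa using hj), zero_mul]

lemma sMul_upperInv_subdiag {A : SMat} (hA : IsUpperBanded 2 A) (hG : QuasiDefinite G) (n : ℕ) :
    (A ⊠ upperInv (S2 G)) (n + 2) (n + 1) =
      A (n + 2) (n + 1) * (S2 G (n + 1) (n + 1))⁻¹ +
        A (n + 2) n * upperInv (S2 G) n (n + 1) := by
  rw [sMul_upper (B := upperInv (S2 G)) (isUpperBanded_upperInv _), Finset.sum_range_succ,
    Finset.sum_range_succ, upperInv_S2_diag hG, Finset.sum_eq_zero]
  · ring
  · intro j hj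
    rw [hA (n + 2) j (by have := Finset.mem_range.1 hj; omega), zero_mul]

/-- The corner case of the subdiagonal formula: no column precedes column `0`, so one term remains.
-/
lemma sMul_upperInv_one_zero (A : SMat) (hG : QuasiDefinite G) :
    (A ⊠ upperInv (S2 G)) 1 0 = A 1 0 * (S2 G 0 0)⁻¹ := by
  rw [sMul_upper (B := upperInv (S2 G)) (isUpperBanded_upperInv _), Finset.sum_range_succ,
    upperInv_S2_diag hG]
  simp

/-- The subdiagonal entries of `S₁`: `s_{n+1} = (S₁)_{n+1,n}`. -/
noncomputable def subS1 (G : SMat) (n : ℕ) : ℂ := S1 G (n + 1) n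

/-- The normalized superdiagonal entries of `S₂⁻¹`: `u_{n+1} = h_{n+1} (S₂⁻¹)_{n,n+1}`. -/
noncomputable def superS2 (G : SMat) (n : ℕ) : ℂ := hDiag G (n + 1) * upperInv (S2 G) n (n + 1)

/-- The ratio `h_{n+1} / h_n`. -/
noncomputable def hRatio (G : SMat) (n : ℕ) : ℂ := S2 G (n + 1) (n + 1) / S2 G n n

lemma S2_superdiag (hG : QuasiDefinite G) (n : ℕ) :
    S2 G n (n + 1) = -S2 G n n * superS2 G n := by
  rw [superS2, hDiag, neg_mul, upperInv_S2_superdiag hG, neg_neg]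

lemma isLowerBanded_S1_Upsilon : IsLowerBanded 2 (S1 G ⊠ Upsilon) := by
  simpa using! (isLowerBanded_S1 G).sMul isLowerBanded_Upsilon

lemma isLowerBanded_S1_Upsilon_transpose : IsLowerBanded 2 (S1 G ⊠ Upsilon.transpose) := by
  simpa using! (isLowerBanded_S1 G).sMul isLowerBanded_Upsilon_transpose

lemma isUpperBanded_S2_Upsilon (hG : QuasiDefinite G) : IsUpperBanded 2 (S2 G ⊠ Upsilon) := by
  simpa using! (isUpperBanded_S2 hG).sMul isUpperBanded_Upsilon

lemma isUpperBanded_S2_Upsilon_transpose (hG : QuasiDefinite G) :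
    IsUpperBanded 2 (S2 G ⊠ Upsilon.transpose) := by
  simpa using! (isUpperBanded_S2 hG).sMul isUpperBanded_Upsilon_transpose

lemma L1_superdiag_even (G : SMat) (m : ℕ) :
    L1 G (2 * m) (2 * m + 1) = -subS1 G (2 * m + 1) := by
  rw [L1, sMul_lowerInv_superdiag isLowerBanded_S1_Upsilon, sMul_Upsilon, sMul_Upsilon,
    cmvSucc_symm_odd, cmvSucc_symm_even, S1_diag, S1_lower _ _ _ (by omega), subS1]
  ring

lemma L1_superdiag_odd (G : SMat) (m : ℕ) :
    L1 G (2 * m + 1) (2 * m + 2) = subS1 G (2 * m) := by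
  rw [L1, sMul_lowerInv_superdiag isLowerBanded_S1_Upsilon, sMul_Upsilon, sMul_Upsilon,
    cmvSucc_symm_even, show 2 * m + 1 + 2 = 2 * (m + 1) + 1 by ring, cmvSucc_symm_odd,
    S1_lower _ _ (2 * (m + 1) + 3) (by omega), subS1]
  ring

lemma L2_superdiag_zero (hG : QuasiDefinite G) (hc : IsCMVMoment c G) : L2 G 0 1 = 1 := by
  rw [L2_eq hG hc, sMul_lowerInv_superdiag isLowerBanded_S1_Upsilon_transpose,
    sMul_Upsilon_transpose, sMul_Upsilon_transpose, cmvSucc_one, S1_diag,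
    cmvSucc_even 1, S1_lower _ _ _ (by omega)]
  ring

lemma L2_superdiag_even (hG : QuasiDefinite G) (hc : IsCMVMoment c G) (m : ℕ) :
    L2 G (2 * m + 2) (2 * m + 3) = subS1 G (2 * m + 1) := by
  rw [L2_eq hG hc, sMul_lowerInv_superdiag isLowerBanded_S1_Upsilon_transpose,
    sMul_Upsilon_transpose, sMul_Upsilon_transpose, cmvSucc_odd,
    show 2 * m + 2 + 2 = 2 * (m + 2) by ring, cmvSucc_even,
    S1_lower _ _ (2 * (m + 2) + 2) (by omega), subS1]
  ring

lemma L2_superdiag_odd (hG : QuasiDefinite G) (hc : IsCMVMoment c G) (m : ℕ) :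
    L2 G (2 * m + 1) (2 * m + 2) = -subS1 G (2 * m + 2) := by
  rw [L2_eq hG hc, sMul_lowerInv_superdiag isLowerBanded_S1_Upsilon_transpose,
    sMul_Upsilon_transpose, sMul_Upsilon_transpose, cmvSucc_odd,
    show 2 * m + 1 + 1 = 2 * (m + 1) by ring, cmvSucc_even,
    S1_lower _ _ (2 * (m + 1) + 2) (by omega), S1_diag, subS1]
  ring_nf

lemma L1_subdiag_zero (hG : QuasiDefinite G) (hc : IsCMVMoment c G) :
    L1 G 1 0 = hRatio G 0 := by
  rw [L1_eq hG hc, sMul_upperInv_one_zero _ hG, sMul_Upsilon, cmvSucc_symm_zero, hRatio,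
    div_eq_mul_inv]

lemma L1_subdiag_even (hG : QuasiDefinite G) (hc : IsCMVMoment c G) (m : ℕ) :
    L1 G (2 * m + 3) (2 * m + 2) = hRatio G (2 * m + 2) * superS2 G (2 * m + 1) := by
  rw [L1_eq hG hc, sMul_upperInv_subdiag (isUpperBanded_S2_Upsilon hG) hG, sMul_Upsilon,
    sMul_Upsilon, show 2 * m + 1 + 1 = 2 * m + 2 by ring, cmvSucc_symm_even, cmvSucc_symm_odd,
    S2_upper hG _ (2 * m) (by omega), hRatio, superS2, hDiag]
  have := S2_diag_ne_zero hG (2 * m + 2)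
  field_simp
  ring

lemma L1_subdiag_odd (hG : QuasiDefinite G) (hc : IsCMVMoment c G) (m : ℕ) :
    L1 G (2 * m + 2) (2 * m + 1) = -(hRatio G (2 * m + 1) * superS2 G (2 * m + 2)) := by
  -- The predecessor of index `2m` is `2m - 2`, except that index `0` is preceded by `1`, since
  -- `z⁻¹` has index `1`; both lie left of the diagonal.
  have h0 : (S2 G ⊠ Upsilon) (2 * m + 2) (2 * m) = 0 := by
    rw [sMul_Upsilon]
    rcases m with _ | m
    · rw [mul_zero, cmvSucc_symm_zero, S2_upper hG _ _ (by omega)]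
    · rw [show 2 * (m + 1) = 2 * m + 2 by ring, cmvSucc_symm_even, S2_upper hG _ _ (by omega)]
  rw [L1_eq hG hc, sMul_upperInv_subdiag (isUpperBanded_S2_Upsilon hG) hG, h0, sMul_Upsilon,
    cmvSucc_symm_odd, S2_superdiag hG, hRatio]
  ring

lemma L2_subdiag_even (hG : QuasiDefinite G) (m : ℕ) :
    L2 G (2 * m + 1) (2 * m) = -(hRatio G (2 * m) * superS2 G (2 * m + 1)) := by
  rcases m with _ | m
  · rw [L2, sMul_upperInv_one_zero _ hG, sMul_Upsilon_transpose]
    rw [cmvSucc_even 0, S2_superdiag hG 1, hRatio]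
    ring
  · rw [L2, show 2 * (m + 1) + 1 = (2 * m + 1) + 2 by ring,
      show 2 * (m + 1) = (2 * m + 1) + 1 by ring,
      sMul_upperInv_subdiag (isUpperBanded_S2_Upsilon_transpose hG) hG,
      sMul_Upsilon_transpose, sMul_Upsilon_transpose,
      show 2 * m + 1 + 1 = 2 * (m + 1) by ring, cmvSucc_even,
      show 2 * (m + 1) + 2 = 2 * m + 1 + 2 + 1 by ring, S2_superdiag hG,
      S2_upper hG _ (cmvSucc (2 * m + 1)), hRatio]
    · ring_nf
    · rcases m with _ | m
      · rw [cmvSucc_one]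
        omega
      · rw [show 2 * (m + 1) + 1 = 2 * m + 3 by ring, cmvSucc_odd]
        omega

lemma L2_subdiag_odd (hG : QuasiDefinite G) (m : ℕ) :
    L2 G (2 * m + 2) (2 * m + 1) = hRatio G (2 * m + 1) * superS2 G (2 * m) := by
  have h0 : S2 G (2 * m + 2) (cmvSucc (2 * m + 1)) = 0 := by
    refine S2_upper hG _ _ ?_
    rcases m with _ | m
    · rw [cmvSucc_one]
      omega
    · rw [show 2 * (m + 1) + 1 = 2 * m + 3 by ring, cmvSucc_odd]
      omega
  rw [L2, sMul_upperInv_subdiag (isUpperBanded_S2_Upsilon_transpose hG) hG,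
    sMul_Upsilon_transpose, sMul_Upsilon_transpose, h0, cmvSucc_even, hRatio, superS2, hDiag]
  have := S2_diag_ne_zero hG (2 * m + 1)
  field_simp
  ring

/-! ### The ratio of consecutive squared norms -/

/-- For an involution `σ` of the CMV indices which reflects the exponents, the matrix
`∑ p, (S₁)_{i,p} (S₂)_{j,σ p}` is symmetric. -/
lemma sum_S1_mul_S2_symm (hc : IsCMVMoment c G) {σ : ℕ → ℕ} {d : ℤ}
    (hσ : ∀ i, cmvExp (σ i) = d - cmvExp i) (i j : ℕ) :
    ∑ p ∈ Finset.range (i + 1), S1 G i p * S2 G j (σ p) =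
      ∑ q ∈ Finset.range (j + 1), S1 G j q * S2 G i (σ q) := by
  have h : ∀ i j, ∑ p ∈ Finset.range (i + 1), S1 G i p * S2 G j (σ p) =
      ∑ p ∈ Finset.range (i + 1), ∑ q ∈ Finset.range (j + 1),
        S1 G i p * S1 G j q * c (cmvExp p + cmvExp q - d) := fun i j => by
    refine Finset.sum_congr rfl fun p _ => ?_
    rw [S2, sMul_lower (S1_lower G), Finset.mul_sum]
    refine Finset.sum_congr rfl fun q _ => ?_
    rw [hc, hσ, mul_assoc]
    congr 3
    ring
  rw [h, h, Finset.sum_comm]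
  refine Finset.sum_congr rfl fun p _ => Finset.sum_congr rfl fun q _ => ?_
  rw [mul_comm (S1 G i q), add_comm (cmvExp q)]

/-- The symmetry is read at `(n, n + 1)`. As `σ` swaps `n` and `n + 1` and preserves the smaller
indices, triangularity of `S₂` leaves one term on one side and two on the other. -/
lemma S2_diag_succ (hG : QuasiDefinite G) (hc : IsCMVMoment c G) {σ : ℕ → ℕ} {d : ℤ}
    (hσ : ∀ i, cmvExp (σ i) = d - cmvExp i) {n : ℕ} (h1 : σ n = n + 1) (h2 : σ (n + 1) = n)
    (h3 : ∀ p < n, σ p < n) :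
    S2 G (n + 1) (n + 1) = S2 G n n + subS1 G n * S2 G n (n + 1) := by
  have h := sum_S1_mul_S2_symm hc hσ n (n + 1)
  rw [Finset.sum_range_succ, Finset.sum_range_succ _ (n + 1), Finset.sum_range_succ _ n,
    Finset.sum_eq_zero, Finset.sum_eq_zero, h1, h2, S1_diag, S1_diag] at h
  · rw [subS1]
    linear_combination h
  · intro p hp
    rw [S2_upper hG _ _ (h3 p (Finset.mem_range.1 hp)), mul_zero]
  · intro p hp
    rw [S2_upper hG _ _ ((h3 p (Finset.mem_range.1 hp)).trans (Nat.lt_succ_self n)), mul_zero]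

/-- The involution of the CMV indices which reflects the exponents by `e ↦ d - e`. -/
noncomputable def cmvReflect (d : ℤ) (i : ℕ) : ℕ := cmvEquiv.symm (d - cmvExp i)

lemma cmvExp_cmvReflect (d : ℤ) (i : ℕ) : cmvExp (cmvReflect d i) = d - cmvExp i :=
  cmvEquiv.apply_symm_apply _

lemma cmvReflect_eq_iff {d : ℤ} {i j : ℕ} : cmvReflect d i = j ↔ cmvExp j = d - cmvExp i := by
  rw [← cmvExp_cmvReflect, cmvExp_bijective.1.eq_iff, eq_comm]

lemma hRatio_eq (hG : QuasiDefinite G) (hc : IsCMVMoment c G) (n : ℕ) :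
    hRatio G n = 1 - subS1 G n * superS2 G n := by
  -- For even `n` the reflection `e ↦ -1 - e` swaps the indices `2a` and `2a + 1`; for odd `n`, `e ↦
  -- -e` swaps `2a + 1` and `2a + 2` and fixes `0`.
  have key : S2 G (n + 1) (n + 1) = S2 G n n + subS1 G n * S2 G n (n + 1) := by
    obtain ⟨m, rfl | rfl⟩ := Nat.even_or_odd' n
    · have e1 : ∀ a, cmvReflect (-1) (2 * a) = 2 * a + 1 := fun a => by
        rw [cmvReflect_eq_iff, cmvExp_even, cmvExp_odd]
        ring
      have e2 : ∀ a, cmvReflect (-1) (2 * a + 1) = 2 * a := fun a => by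
        rw [cmvReflect_eq_iff, cmvExp_even, cmvExp_odd]
        ring
      refine S2_diag_succ hG hc (cmvExp_cmvReflect (-1)) (e1 m) (e2 m) fun p hp => ?_
      obtain ⟨a, rfl | rfl⟩ := Nat.even_or_odd' p
      · rw [e1]
        omega
      · rw [e2]
        omega
    · have e1 : ∀ a, cmvReflect 0 (2 * a + 1) = 2 * a + 1 + 1 := fun a => by
        rw [cmvReflect_eq_iff, cmvExp_odd, show 2 * a + 1 + 1 = 2 * (a + 1) by ring, cmvExp_even]
        push_cast
        ring
      have e2 : ∀ a, cmvReflect 0 (2 * a + 1 + 1) = 2 * a + 1 := fun a => by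
        rw [cmvReflect_eq_iff, cmvExp_odd, show 2 * a + 1 + 1 = 2 * (a + 1) by ring, cmvExp_even]
        push_cast
        ring
      refine S2_diag_succ hG hc (cmvExp_cmvReflect 0) (e1 m) (e2 m) fun p hp => ?_
      rcases p with _ | p
      · rw [cmvReflect_eq_iff.2 (show cmvExp 0 = 0 - cmvExp 0 by simp [cmvExp])]
        exact hp
      · obtain ⟨a, rfl | rfl⟩ := Nat.even_or_odd' p
        · rw [e1]
          omega
        · rw [e2]
          omega
  have h0 := S2_diag_ne_zero hG n
  rw [hRatio, key, S2_superdiag hG]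
  field_simp
  ring

end Gauss

/-! ### The Verblunsky coefficients as entries of the factors -/

lemma coeff_sum_C_mul_T (f : ℕ → ℂ) (l j : ℕ) (hj : j ≤ l) :
    (∑ k ∈ Finset.range (l + 1),
      LaurentPolynomial.C (f k) * LaurentPolynomial.T (cmvExp k)).coeff (cmvExp j) = f j := by
  simp only [← LaurentPolynomial.single_eq_C_mul_T, AddMonoidAlgebra.coeff_sum,
    Finsupp.finsetSum_apply, AddMonoidAlgebra.coeff_single, Finsupp.single_apply,
    cmvExp_bijective.1.eq_iff]
  rw [Finset.sum_ite_eq' _ j, if_pos (Finset.mem_range_succ_iff.2 hj)]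

lemma coeff_phi1 (G : SMat) {l j : ℕ} (hj : j ≤ l) : (phi1 G l).coeff (cmvExp j) = S1 G l j :=
  coeff_sum_C_mul_T _ l j hj

lemma coeff_phi2 (G : SMat) {l j : ℕ} (hj : j ≤ l) :
    (phi2 G l).coeff (cmvExp j) = conj (upperInv (S2 G) j l) :=
  coeff_sum_C_mul_T (fun j => conj (upperInv (S2 G) j l)) l j hj

lemma neg_half_even (m : ℕ) : -(((2 * m + 2) / 2 : ℕ) : ℤ) = cmvExp (2 * m + 1) := by
  rw [cmvExp_odd]
  omega

lemma half_odd (m : ℕ) : (((2 * m + 1) / 2 : ℕ) : ℤ) = cmvExp (2 * m) := by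
  rw [cmvExp_even]
  omega

lemma alpha1_zero (G : SMat) : alpha1 G 0 = 1 := by
  have := coeff_phi1 G (le_refl 0)
  simpa [alpha1, cmvExp, S1_diag] using this

lemma alpha2_zero {G : SMat} (hG : QuasiDefinite G) : alpha2 G 0 = 1 := by
  have := coeff_phi2 G (le_refl 0)
  rw [show cmvExp 0 = 0 by simp [cmvExp], upperInv_S2_diag hG] at this
  have h0 := S2_diag_ne_zero hG 0
  rw [alpha2, if_pos (by simp), Nat.zero_div, Nat.cast_zero, neg_zero, this, hDiag, ← map_mul,
    mul_inv_cancel₀ h0, map_one]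

/-- This and the next three identities hold for every matrix, so they may be used along a whole
curve before differentiating. In each, the conjugations cancel, which is why complex derivatives
make sense. -/
lemma alpha1_even (G : SMat) (m : ℕ) : alpha1 G (2 * m + 2) = subS1 G (2 * m + 1) := by
  rw [alpha1, if_pos ⟨m + 1, by ring⟩, neg_half_even, coeff_phi1 G (by omega), subS1]

lemma alpha1_odd (G : SMat) (m : ℕ) : alpha1 G (2 * m + 1) = superS2 G (2 * m) := by
  rw [alpha1, if_neg (by simp), half_odd, coeff_phi2 G (by omega), ← map_mul,
    Complex.conj_conj, superS2]

lemma conj_alpha2_even (G : SMat) (m : ℕ) :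
    conj (alpha2 G (2 * m + 2)) = superS2 G (2 * m + 1) := by
  rw [alpha2, if_pos ⟨m + 1, by ring⟩, neg_half_even, coeff_phi2 G (by omega), ← map_mul,
    Complex.conj_conj, superS2]

lemma conj_alpha2_odd (G : SMat) (m : ℕ) :
    conj (alpha2 G (2 * m + 1)) = subS1 G (2 * m) := by
  rw [alpha2, if_neg (by simp), half_odd, coeff_phi1 G (by omega), Complex.conj_conj, subS1]

lemma one_sub_alpha_mul {G : SMat} {c : ℤ → ℂ} (hG : QuasiDefinite G) (hc : IsCMVMoment c G)
    (n : ℕ) : 1 - alpha1 G (n + 1) * conj (alpha2 G (n + 1)) = hRatio G n := by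
  rw [hRatio_eq hG hc]
  obtain ⟨m, rfl | rfl⟩ := Nat.even_or_odd' n
  · rw [alpha1_odd, conj_alpha2_odd, mul_comm]
  · rw [alpha1_even, conj_alpha2_even]

/-! ### The two flows -/

section Flow

variable {Γ : ℂ → SMat} {s₀ : ℂ} {X Z : SMat}

lemma hasDerivAt_subS1 (hX : ∀ i j, i ≤ j → X i j = 0)
    (hS : HasEntryDeriv (fun s => S1 (Γ s)) (X ⊠ S1 (Γ s₀)) s₀) (n : ℕ) :
    HasDerivAt (fun s => subS1 (Γ s) n) (X (n + 1) n) s₀ := by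
  refine (hS (n + 1) n).congr_deriv ?_
  rw [sMul_eq_sum (n + 1) fun j hj => by rw [hX _ _ hj, zero_mul], Finset.sum_range_succ,
    S1_diag, mul_one, Finset.sum_eq_zero, zero_add]
  intro j hj
  rw [S1_lower _ _ _ (Finset.mem_range.1 hj), mul_zero]

/-- Normalizing by `h_{n+1}` makes the diagonal contribution `Z_{n+1,n+1}` cancel between `S₂' = Z
S₂` and `(S₂⁻¹)' = -S₂⁻¹ Z`. -/
lemma hasDerivAt_superS2 (hG : QuasiDefinite (Γ s₀)) (hZ : IsUpperBanded 0 Z)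
    (hT : HasEntryDeriv (fun s => S2 (Γ s)) (Z ⊠ S2 (Γ s₀)) s₀)
    (hV : HasEntryDeriv (fun s => upperInv (S2 (Γ s))) (-(upperInv (S2 (Γ s₀)) ⊠ Z)) s₀) (n : ℕ) :
    HasDerivAt (fun s => superS2 (Γ s) n) (-hRatio (Γ s₀) n * Z n (n + 1)) s₀ := by
  refine ((hT (n + 1) (n + 1)).mul (hV n (n + 1))).congr_deriv ?_
  have e1 : (Z ⊠ S2 (Γ s₀)) (n + 1) (n + 1) = Z (n + 1) (n + 1) * S2 (Γ s₀) (n + 1) (n + 1) := by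
    rw [sMul_upper (S2_upper hG), Finset.sum_range_succ, Finset.sum_eq_zero, zero_add]
    intro j hj
    rw [hZ (n + 1) j (by simpa using hj), zero_mul]
  have e2 : (upperInv (S2 (Γ s₀)) ⊠ Z) n (n + 1) = (S2 (Γ s₀) n n)⁻¹ * Z n (n + 1) +
      upperInv (S2 (Γ s₀)) n (n + 1) * Z (n + 1) (n + 1) := by
    rw [sMul_upper (B := Z) hZ, Finset.sum_range_succ, Finset.sum_range_succ,
      Finset.sum_eq_zero, upperInv_S2_diag hG, zero_add]
    intro j hj
    rw [isUpperBanded_upperInv _ n j (by simpa using hj), zero_mul]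
  rw [e1, Matrix.neg_apply, e2, hRatio]
  ring

end Flow

/-- Since `[A, A] = 0`, the generators `X` and `Z`, which differ by a Lax matrix up to sign, are
interchangeable in the equation of that matrix. -/
lemma IsLowerBanded.sComm_add_self {A : SMat} {p : ℕ} {X : SMat} {q : ℕ}
    (hX : IsLowerBanded q X) (hA : IsLowerBanded p A) : sComm (X + A) A = sComm X A := by
  rw [sComm, sComm, hX.add_sMul hA, hA.sMul_add]
  abel

lemma IsUpperBanded.sComm_add_self {A : SMat} {p : ℕ} {X : SMat} {q : ℕ}
    (hX : IsUpperBanded q X) (hA : IsUpperBanded p A) : sComm (X + A) A = sComm X A := by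
  rw [isUpperBanded_iff] at hX
  have hA' := isUpperBanded_iff.1 hA
  have e : A ⊠ (X + A) = A ⊠ X + A ⊠ A := by
    apply Matrix.transpose_injective
    simp only [transpose_sMul, Matrix.transpose_add]
    exact hX.add_sMul hA' _
  rw [sComm, sComm, hA.add_sMul, e]
  abel

/-- The Lax equations and the evolution of the entries next to the diagonal of the factors, for
the flow `G' = Υ G`. -/
lemma flow_fst {Γ : ℂ → SMat} {s₀ : ℂ} (hΓ : HasEntryDeriv Γ (Upsilon ⊠ Γ s₀) s₀)
    (hG : QuasiDefinite (Γ s₀)) :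
    HasEntryDeriv (fun s => L1 (Γ s)) (sComm (B11 (Γ s₀)) (L1 (Γ s₀))) s₀ ∧
    HasEntryDeriv (fun s => L2 (Γ s)) (sComm (B11 (Γ s₀)) (L2 (Γ s₀))) s₀ ∧
    ∀ n, HasDerivAt (fun s => subS1 (Γ s) n) (-L1 (Γ s₀) (n + 1) n) s₀ ∧
      HasDerivAt (fun s => superS2 (Γ s) n) (-hRatio (Γ s₀) n * L1 (Γ s₀) n (n + 1)) s₀ := by
  obtain ⟨X, Z, hX, hZ, hXZ, hS, hT, hV, h1, h2⟩ := exists_factor_derivs hΓ hG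
  rw [S1_conj hG isLowerBanded_Upsilon] at hXZ
  change X + L1 (Γ s₀) = Z at hXZ
  -- `L₁ = Z - X` is a splitting into upper and strictly lower parts, so `Z` is the upper part.
  have hB : B11 (Γ s₀) = Z := by
    ext i j
    rw [B11, upperPart]
    split_ifs with h
    · rw [← hXZ, Matrix.add_apply, hX i j h, zero_add]
    · rw [hZ i j (by omega)]
  have hXb : IsLowerBanded 0 X := fun i j h => hX i j (by omega)
  rw [hB]
  refine ⟨?_, h2, fun n => ⟨?_, ?_⟩⟩
  · rwa [← hXZ, hXb.sComm_add_self (isLowerBanded_L1 _)]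
  · refine (hasDerivAt_subS1 hX hS n).congr_deriv ?_
    have := hZ (n + 1) n (by omega)
    rw [← hXZ, Matrix.add_apply] at this
    exact eq_neg_of_add_eq_zero_left this
  · refine (hasDerivAt_superS2 hG hZ hT hV n).congr_deriv ?_
    rw [← hXZ, Matrix.add_apply, hX n (n + 1) (by omega), zero_add]

/-- The Lax equations and the evolution of the entries next to the diagonal of the factors, for
the flow `G' = -G Υᵀ`. -/
lemma flow_snd {Γ : ℂ → SMat} {s₀ : ℂ} (hΓ : HasEntryDeriv Γ (-(Γ s₀ ⊠ Upsilon.transpose)) s₀)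
    (hG : QuasiDefinite (Γ s₀)) :
    HasEntryDeriv (fun s => L1 (Γ s)) (sComm (B21 (Γ s₀)) (L1 (Γ s₀))) s₀ ∧
    HasEntryDeriv (fun s => L2 (Γ s)) (sComm (B21 (Γ s₀)) (L2 (Γ s₀))) s₀ ∧
    ∀ n, HasDerivAt (fun s => subS1 (Γ s) n) (L2 (Γ s₀) (n + 1) n) s₀ ∧
      HasDerivAt (fun s => superS2 (Γ s) n) (hRatio (Γ s₀) n * L2 (Γ s₀) n (n + 1)) s₀ := by
  obtain ⟨X, Z, hX, hZ, hXZ, hS, hT, hV, h1, h2⟩ := exists_factor_derivs hΓ hG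
  rw [sMul_neg, neg_sMul, S2_conj isUpperBanded_Upsilon_transpose] at hXZ
  replace hXZ : X = Z + L2 (Γ s₀) := by
    rw [← hXZ]
    exact (neg_add_cancel_right X _).symm
  have hB : B21 (Γ s₀) = X := by
    ext i j
    rw [B21, strictLowerPart]
    split_ifs with h
    · rw [hXZ, Matrix.add_apply, hZ i j (by omega), zero_add]
    · rw [hX i j (by omega)]
  rw [hB]
  refine ⟨h1, ?_, fun n => ⟨?_, ?_⟩⟩
  · rwa [hXZ, hZ.sComm_add_self (isUpperBanded_L2 hG)]
  · refine (hasDerivAt_subS1 hX hS n).congr_deriv ?_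
    rw [hXZ, Matrix.add_apply, hZ (n + 1) n (by omega), zero_add]
  · refine (hasDerivAt_superS2 hG hZ hT hV n).congr_deriv ?_
    have := hX n (n + 1) (by omega)
    rw [hXZ, Matrix.add_apply] at this
    rw [eq_neg_of_add_eq_zero_left this]
    ring

/-! ### The deformed moment matrix as a solution of the two linear flows -/

section Deformed

variable {μ : ComplexMeasure Circle} {t₁ t₂ : ℕ+ → ℂ}

lemma isCMVMoment_deformed (ht₁ : Summable fun j => ‖t₁ j‖) (ht₂ : Summable fun j => ‖t₂ j‖) :
    IsCMVMoment (deformedMoment μ t₁ t₂) (deformed μ t₁ t₂) :=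
  deformed_apply μ ht₁ ht₂

lemma hasEntryDeriv_deformed_fst (ht₁ : Summable fun j => ‖t₁ j‖)
    (ht₂ : Summable fun j => ‖t₂ j‖) :
    HasEntryDeriv (fun s => deformed μ (Function.update t₁ 1 s) t₂)
      (Upsilon ⊠ deformed μ t₁ t₂) (t₁ 1) := fun i j => by
  simp only [fun s => deformed_apply μ (summable_norm_update ht₁ s) ht₂, Upsilon_sMul,
    deformed_apply μ ht₁ ht₂, cmvExp_cmvSucc]
  rw [show cmvExp i + 1 - cmvExp j = cmvExp i - cmvExp j + 1 by ring]
  exact hasDerivAt_deformedMoment_fst μ t₂ ht₁ _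

lemma hasEntryDeriv_deformed_snd (ht₁ : Summable fun j => ‖t₁ j‖)
    (ht₂ : Summable fun j => ‖t₂ j‖) :
    HasEntryDeriv (fun s => deformed μ t₁ (Function.update t₂ 1 s))
      (-(deformed μ t₁ t₂ ⊠ Upsilon.transpose)) (t₂ 1) := fun i j => by
  simp only [fun s => deformed_apply μ ht₁ (summable_norm_update ht₂ s), Matrix.neg_apply,
    sMul_Upsilon_transpose, deformed_apply μ ht₁ ht₂, cmvExp_cmvSucc]
  rw [show cmvExp i - (cmvExp j + 1) = cmvExp i - cmvExp j - 1 by ring]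
  exact hasDerivAt_deformedMoment_snd μ t₁ ht₂ _

end Deformed

end OLPUC

theorem mainTheorem9 (μ : ComplexMeasure Circle) (t₁ t₂ : ℕ+ → ℂ)
    (ht₁ : Summable fun j => ‖t₁ j‖) (ht₂ : Summable fun j => ‖t₂ j‖)
    (G : SMat) (hG : G = deformed μ t₁ t₂) (hqd : QuasiDefinite G) :
    LaxEquations μ t₁ t₂ ∧
    ∀ k : ℕ, 1 ≤ k →
      HasDeriv11 μ t₁ t₂ (fun A => alpha1 A k)
        (alpha1 G (k + 1) * (1 - alpha1 G k * conj (alpha2 G k))) ∧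
      HasDeriv11 μ t₁ t₂ (fun A => conj (alpha2 A k))
        (-conj (alpha2 G (k - 1)) * (1 - alpha1 G k * conj (alpha2 G k))) ∧
      HasDeriv21 μ t₁ t₂ (fun A => alpha1 A k)
        (alpha1 G (k - 1) * (1 - alpha1 G k * conj (alpha2 G k))) ∧
      HasDeriv21 μ t₁ t₂ (fun A => conj (alpha2 A k))
        (-conj (alpha2 G (k + 1)) * (1 - alpha1 G k * conj (alpha2 G k))) := by
  have hc : IsCMVMoment (deformedMoment μ t₁ t₂) G := hG ▸ isCMVMoment_deformed ht₁ ht₂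
  have D1 := hasEntryDeriv_deformed_fst (μ := μ) ht₁ ht₂
  have D2 := hasEntryDeriv_deformed_snd (μ := μ) ht₁ ht₂
  have e1 : deformed μ (Function.update t₁ 1 (t₁ 1)) t₂ = G := by
    rw [Function.update_eq_self, hG]
  have e2 : deformed μ t₁ (Function.update t₂ 1 (t₂ 1)) = G := by
    rw [Function.update_eq_self, hG]
  have F1 := flow_fst (Γ := fun s => deformed μ (Function.update t₁ 1 s) t₂) (s₀ := t₁ 1)
    (by simpa only [e1, ← hG] using D1) (by simpa only [e1] using hqd)
  have F2 := flow_snd (Γ := fun s => deformed μ t₁ (Function.update t₂ 1 s)) (s₀ := t₂ 1)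
    (by simpa only [e2, ← hG] using D2) (by simpa only [e2] using hqd)
  simp only [e1] at F1
  simp only [e2] at F2
  obtain ⟨L11, L12, F1⟩ := F1
  obtain ⟨L21, L22, F2⟩ := F2
  refine ⟨?_, fun k hk => ?_⟩
  · simp only [LaxEquations, ← hG]
    exact fun i j => ⟨L11 i j, L21 i j, L12 i j, L22 i j⟩
  · obtain ⟨n, rfl⟩ := Nat.exists_eq_add_of_le' hk
    -- With `k = n + 1` the common factor is the ratio `h_{n+1} / h_n`.
    rw [one_sub_alpha_mul hqd hc, Nat.add_sub_cancel]
    unfold HasDeriv11 HasDeriv21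
    obtain ⟨m, rfl | rfl⟩ := Nat.even_or_odd' n
    -- Odd `k`: `α⁽¹⁾` is the entry of the normalized `S₂⁻¹` and `conj α⁽²⁾` that of `S₁`.
    · simp only [alpha1_odd, conj_alpha2_odd, alpha1_even, conj_alpha2_even,
        show 2 * m + 1 + 1 = 2 * m + 2 from rfl]
      refine ⟨(F1 _).2.congr_deriv ?_, (F1 _).1.congr_deriv ?_, (F2 _).2.congr_deriv ?_,
        (F2 _).1.congr_deriv ?_⟩
      · rw [L1_superdiag_even]
        ring
      -- The case `k = 1` reaches the boundary value `α₀ = 1`, which matches the exceptional corner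
      -- entry of the Lax matrix.
      · rcases m with _ | m
        · rw [mul_zero, L1_subdiag_zero hqd hc, alpha2_zero hqd, map_one]
          ring
        · rw [show 2 * (m + 1) = 2 * m + 2 by ring, conj_alpha2_even, L1_subdiag_even hqd hc]
          ring
      · rcases m with _ | m
        · rw [mul_zero, L2_superdiag_zero hqd hc, alpha1_zero]
          ring
        · rw [show 2 * (m + 1) = 2 * m + 2 by ring, alpha1_even, L2_superdiag_even hqd hc]
          ring
      · rw [L2_subdiag_even hqd]
        ring
    -- Even `k`: the two factors exchange roles, and no boundary case occurs.
    · simp only [alpha1_odd, conj_alpha2_odd, alpha1_even, conj_alpha2_even,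
        show 2 * m + 1 + 1 = 2 * m + 2 from rfl,
        show 2 * m + 2 + 1 = 2 * (m + 1) + 1 from rfl]
      refine ⟨(F1 _).1.congr_deriv ?_, (F1 _).2.congr_deriv ?_, (F2 _).1.congr_deriv ?_,
        (F2 _).2.congr_deriv ?_⟩
      · rw [show 2 * m + 1 + 1 = 2 * m + 2 from rfl, L1_subdiag_odd hqd hc]
        ring_nf
      · rw [show 2 * m + 1 + 1 = 2 * m + 2 from rfl, L1_superdiag_odd]
        ring
      · rw [show 2 * m + 1 + 1 = 2 * m + 2 from rfl, L2_subdiag_odd hqd]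
        ring
      · rw [show 2 * m + 1 + 1 = 2 * m + 2 from rfl, L2_superdiag_odd hqd hc]
        ring_nf
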